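/- For real $q>1$, an expansion of a real number $x$ in base $q$ is a sequence $(c_i)_{i\ge1}$ of integers with $0\le c_i<q$ for all $i$ and $x=\sum_{i\ge1}c_iq^{-i}$. Let $\mathcal U$ be the set of all real $q>1$ for which $1$ has exactly one expansion in base $q$, and let $\overline{\mathcal U}$ be its closure in $\mathbb R$. For $q>1$, let $\mathcal U_q$ be the set of real numbers with exactly one expansion in base $q$, and put $J_q=\bigl[0,\frac{\lceil q\rceil-1}{q-1}\bigr]$. For $x\in J_q\setminus\{0\}$, the quasi-greedy expansion $(a_i(x))$ of $x$ is the lexicographically largest expansion of $x$ in base $q$ with infinitely many nonzero digits; for $x=0$ put $(a_i(0))=0^\infty$. Write $(\alpha_i)=(a_i(1))$ and $\overline{c}=\alpha_1-c$ for a digit $c\in\{0,\dots,\alpha_1\}$, and let $$\mathcal V_q=\bigl\{x\in J_q:\ \overline{a_{n+1}(x)}\;\overline{a_{n+2}(x)}\ldots\le\alpha_1\alpha_2\ldots\ \text{ in the lexicographical order whenever } a_n(x)>0\bigr\}.$$ Theorem 1.3. Suppose that $q\in\overline{\mathcal U}$. Then (i) the closure $\overline{\mathcal U_q}$ of $\mathcal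 U_q$ in $\mathbb R$ equals $\mathcal V_q$; (ii) $|\mathcal V_q\setminus\mathcal U_q|=\aleph_0$, and $\mathcal V_q\setminus\mathcal U_q$ is dense in $\mathcal V_q$; (iii) if $q\in\mathcal U$, then each $x\in\mathcal V_q\setminus\mathcal U_q$ has exactly $2$ expansions in base $q$; (iv) if $q\in\overline{\mathcal U}\setminus\mathcal U$, then each $x\in\mathcal V_q\setminus\mathcal U_q$ has exactly $\aleph_0$ expansions in base $q$. -/

import Mathlib

noncomputable section

namespace UniqueExpansions

/-- `c` is an expansion of `x` in base `q`: every digit is smaller than `q`, and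
`x = c₁ / q + c₂ / q ^ 2 + ⋯`. Sequences are indexed from `0`, so `c i` is the digit that is
usually written with index `i + 1`. -/
def IsExpansion (q x : ℝ) (c : ℕ → ℕ) : Prop :=
  (∀ i, (c i : ℝ) < q) ∧ HasSum (fun i => (c i : ℝ) / q ^ (i + 1)) x

/-- The set of all expansions of `x` in base `q`. -/
def expansions (q x : ℝ) : Set (ℕ → ℕ) := {c | IsExpansion q x c}

/-- A sequence is infinite if it has infinitely many nonzero elements. -/
def IsInfiniteSeq (c : ℕ → ℕ) : Prop := {i | c i ≠ 0}.Infinite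

/-- The set `𝒰` of univoque bases: those `q > 1` in which `1` has exactly one expansion. -/
def univoqueBases : Set ℝ := {q | 1 < q ∧ ∃! c, IsExpansion q 1 c}

/-- The set `𝒰_q` of the numbers with exactly one expansion in base `q`. -/
def U (q : ℝ) : Set ℝ := {x | ∃! c, IsExpansion q x c}

/-- The interval `J_q = [0, (⌈q⌉ - 1) / (q - 1)]`. -/
def J (q : ℝ) : Set ℝ := Set.Icc 0 (((⌈q⌉ : ℝ) - 1) / (q - 1))

/-- `a` is the quasi-greedy expansion of `x` in base `q`: the lexicographically largest infinite
expansion of `x` if `x ≠ 0`, and the zero sequence if `x = 0`. There is at most one such `a`. -/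
def IsQuasiGreedy (q x : ℝ) (a : ℕ → ℕ) : Prop :=
  (x = 0 ∧ a = 0) ∨
    (x ≠ 0 ∧ IsGreatest
      {b : Lex (ℕ → ℕ) | IsExpansion q x (ofLex b) ∧ IsInfiniteSeq (ofLex b)} (toLex a))

/-- The set `𝒱_q`: those `x ∈ J_q` whose quasi-greedy expansion `a` satisfies, after each nonzero
digit, that the conjugate of the remaining tail is lexicographically at most `α`, where `α` is the
quasi-greedy expansion of `1`. The conjugate of a digit `d` is `α 0 - d`; no truncation occurs,
since the digits in base `q` are at most `⌈q⌉ - 1 = α 0`. -/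
def V (q : ℝ) : Set ℝ :=
  {x | x ∈ J q ∧ ∃ α a : ℕ → ℕ, IsQuasiGreedy q 1 α ∧ IsQuasiGreedy q x a ∧
    ∀ n, 0 < a n → toLex (fun i => α 0 - a (n + 1 + i)) ≤ toLex α}

end UniqueExpansions

end

/-! Write `M = ⌈q⌉ - 1` and `α` for the quasi-greedy expansion of 1. Everything is read off from
weak sequences (`Weak`): after a digit below `M` the tail is at most `α`, and likewise for the
reflected sequence. For such tails lexicographic order controls values: the value is at most 1, with
equality only for `α` itself (`val_le_one`, `val_lt_one`). The values of weak sequences form exactly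
`V q` (`mem_V_iff`). A second expansion of such a value can split off only where a weak inequality
is an equality, and it is then determined (`expansions_eq`). So the number of expansions is one plus
the number of branch positions, and `U q` corresponds to having none.

The hypothesis on `q` enters only through `Star`: every reflected tail of `α` is strictly below `α`
(`Base.star`). Univoque bases have this by uniqueness, and it survives limits because an equality in
the limit would already force one in the approximants.

Under `Star`, a weak sequence may be cut at a well-chosen late position and continued by `α`
(`exists_decided`, `weak_splice`). This approximates points of `U q` by branching ones, which gives
density, and makes every branching point an accumulation point of `V q`. Branching sequences end in
`α` or its reflection, so `V q \ U q` is countable. A part of the closed set `V q` away from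
`closure (U q)` would be perfect and countable, hence empty; this gives (i).

For (iii) and (iv), upper and lower branches cannot coexist under `Star`. If `α` has no branch of
its own, which means that `q` is univoque, branch positions are unique; otherwise a branch recurs
forever inside the tail `α`. -/

noncomputable section

namespace UniqueExpansions

open Filter Topology

/-! ### Lexicographic order on sequences -/

/-- `a` is lexicographically at most `b`. -/
def LexLe (a b : ℕ → ℕ) : Prop := ∀ p, (∀ i < p, a i = b i) → a p ≤ b p

/-- `a` is lexicographically smaller than `b`. -/
def LexLt (a b : ℕ → ℕ) : Prop := ∃ p, (∀ i < p, a i = b i) ∧ a p < b p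

theorem not_lexLt {a b : ℕ → ℕ} : ¬ LexLt a b ↔ LexLe b a := by
  unfold LexLt LexLe
  push Not
  exact forall_congr' fun p => imp_congr_left (forall₂_congr fun i _ => eq_comm)

theorem exists_first_diff {a b : ℕ → ℕ} (h : a ≠ b) :
    ∃ p, (∀ i < p, a i = b i) ∧ a p ≠ b p := by
  have h' : ∃ p, a p ≠ b p := by
    by_contra! h'
    exact h (funext h')
  classical
  refine ⟨Nat.find h', fun i hi => ?_, Nat.find_spec h'⟩
  simpa using Nat.find_min h' hi

theorem LexLt.ne {a b : ℕ → ℕ} (h : LexLt a b) : a ≠ b := by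
  rintro rfl
  obtain ⟨p, _, hp⟩ := h
  exact lt_irrefl _ hp

theorem LexLe.lt_of_ne {a b : ℕ → ℕ} (h : LexLe a b) (hne : a ≠ b) : LexLt a b := by
  obtain ⟨p, hp, hpne⟩ := exists_first_diff hne
  exact ⟨p, hp, lt_of_le_of_ne (h p hp) hpne⟩

theorem LexLt.le {a b : ℕ → ℕ} (h : LexLt a b) : LexLe a b := by
  rw [← not_lexLt]
  rintro ⟨p, hp, hlt⟩
  obtain ⟨r, hr, hlt'⟩ := h
  rcases lt_trichotomy p r with hpr | rfl | hpr
  · exact absurd (hr p hpr) hlt.ne'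
  · exact lt_asymm hlt hlt'
  · exact absurd (hp r hpr) hlt'.ne'

theorem toLex_le_iff {a b : ℕ → ℕ} : toLex a ≤ toLex b ↔ LexLe a b := by
  rw [← not_lt]
  exact not_lexLt

/-! ### Shifts and reflections -/

/-- The sequence `c` without its first `n` terms. -/
def shift (n : ℕ) (c : ℕ → ℕ) : ℕ → ℕ := fun i => c (n + i)

/-- The reflection of a sequence with digits in `{0, …, M}`. -/
def conj (M : ℕ) (c : ℕ → ℕ) : ℕ → ℕ := fun i => M - c i

/-- All terms of `c` are at most `M`. -/
def Digits (M : ℕ) (c : ℕ → ℕ) : Prop := ∀ i, c i ≤ M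

@[simp]
theorem shift_zero (c : ℕ → ℕ) : shift 0 c = c := by
  funext i
  simp [shift]

theorem shift_shift (m n : ℕ) (c : ℕ → ℕ) : shift m (shift n c) = shift (n + m) c := by
  funext i
  simp [shift, add_assoc]

theorem conj_shift (M n : ℕ) (c : ℕ → ℕ) : conj M (shift n c) = shift n (conj M c) := rfl

theorem Digits.digits_shift {M : ℕ} {c : ℕ → ℕ} (h : Digits M c) (n : ℕ) : Digits M (shift n c) :=
  fun i => h (n + i)

theorem digits_conj (M : ℕ) (c : ℕ → ℕ) : Digits M (conj M c) := fun _ => Nat.sub_le _ _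

theorem Digits.conj_conj {M : ℕ} {c : ℕ → ℕ} (h : Digits M c) : conj M (conj M c) = c := by
  funext i
  have := h i
  simp only [conj]
  omega

/-! ### The value of a sequence in base `q` -/

/-- The value of a sequence of digits in base `q`. -/
def val (q : ℝ) (c : ℕ → ℕ) : ℝ := ∑' i, (c i : ℝ) / q ^ (i + 1)

variable {q : ℝ} {M : ℕ}

theorem hasSum_const (hq : 1 < q) (m : ℝ) : HasSum (fun i : ℕ => m / q ^ (i + 1)) (m / (q - 1)) := by
  have h0 : 0 < q := by linarith
  have h := (hasSum_geometric_of_lt_one (inv_nonneg.2 h0.le) (inv_lt_one_of_one_lt₀ hq)).mul_left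
    (m / q)
  have e : m / q * (1 - q⁻¹)⁻¹ = m / (q - 1) := by
    have : q - 1 ≠ 0 := by linarith
    have h2 : 1 - q⁻¹ = (q - 1) / q := by field_simp
    rw [h2]
    field_simp
  rw [e] at h
  refine h.congr_fun ?_ |> fun h => h
  intro i
  rw [inv_pow, pow_succ]
  field_simp

theorem Digits.summable (hq : 1 < q) {c : ℕ → ℕ} (hc : Digits M c) :
    Summable fun i => (c i : ℝ) / q ^ (i + 1) := by
  have h0 : 0 < q := by linarith
  refine Summable.of_nonneg_of_le (fun i => by positivity) (fun i => ?_) (hasSum_const hq M).summable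
  have : (c i : ℝ) ≤ M := by exact_mod_cast hc i
  gcongr

theorem Digits.hasSum (hq : 1 < q) {c : ℕ → ℕ} (hc : Digits M c) :
    HasSum (fun i => (c i : ℝ) / q ^ (i + 1)) (val q c) := (hc.summable hq).hasSum

theorem Digits.val_split (hq : 1 < q) {c : ℕ → ℕ} (hc : Digits M c) (n : ℕ) :
    val q c = ∑ i ∈ Finset.range n, (c i : ℝ) / q ^ (i + 1) + val q (shift n c) / q ^ n := by
  have h0 : 0 < q := by linarith
  rw [val, ← (hc.summable hq).sum_add_tsum_nat_add n, val, ← tsum_div_const]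
  congr 2
  funext i
  simp only [shift]
  rw [div_div, ← pow_add, add_comm i n]
  congr 2
  ring

theorem Digits.val_head (hq : 1 < q) {c : ℕ → ℕ} (hc : Digits M c) :
    q * val q c = c 0 + val q (shift 1 c) := by
  have h0 : 0 < q := by linarith
  rw [hc.val_split hq 1]
  simp
  field_simp

theorem Digits.val_shift (hq : 1 < q) {c : ℕ → ℕ} (hc : Digits M c) (n : ℕ) :
    q * val q (shift n c) = c n + val q (shift (n + 1) c) := by
  rw [(hc.digits_shift n).val_head hq, shift_shift]
  simp [shift]

theorem val_nonneg (hq : 1 < q) (c : ℕ → ℕ) : 0 ≤ val q c :=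
  tsum_nonneg fun i => by positivity

theorem Digits.val_conj (hq : 1 < q) {c : ℕ → ℕ} (hc : Digits M c) :
    val q (conj M c) = M / (q - 1) - val q c := by
  rw [val, val, ← (hasSum_const hq M).tsum_eq, ← (hasSum_const hq M).summable.tsum_sub (hc.summable hq)]
  congr 1
  funext i
  rw [conj, Nat.cast_sub (hc i), sub_div]

theorem Digits.val_le (hq : 1 < q) {c : ℕ → ℕ} (hc : Digits M c) : val q c ≤ M / (q - 1) := by
  have := val_nonneg hq (conj M c)
  rw [hc.val_conj hq] at this
  linarith

theorem Digits.eq_zero_of_val (hq : 1 < q) {c : ℕ → ℕ} (hc : Digits M c) (h : val q c = 0) :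
    c = 0 := by
  have h0 : 0 < q := by linarith
  have hs := hc.hasSum hq
  rw [h, hasSum_zero_iff_of_nonneg (fun i => by positivity)] at hs
  funext i
  have := congrFun hs i
  simpa [h0.ne'] using this

theorem val_zero (q : ℝ) : val q 0 = 0 := by simp [val]

/-- Two sequences with a common prefix of length `n`. -/
theorem Digits.val_sub (hq : 1 < q) {a b : ℕ → ℕ} (ha : Digits M a) (hb : Digits M b) {n : ℕ}
    (h : ∀ i < n, a i = b i) :
    val q a - val q b = (val q (shift n a) - val q (shift n b)) / q ^ n := by
  rw [ha.val_split hq n, hb.val_split hq n, Finset.sum_congr rfl (fun i hi => by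
    rw [h i (Finset.mem_range.1 hi)])]
  ring

theorem Digits.val_sub' (hq : 1 < q) {a b : ℕ → ℕ} (ha : Digits M a) (hb : Digits M b) {n : ℕ}
    (h : ∀ i < n, a i = b i) :
    val q a - val q b = ((a n + val q (shift (n + 1) a)) -
      (b n + val q (shift (n + 1) b))) / q ^ (n + 1) := by
  have h0 : 0 < q := by linarith
  rw [ha.val_sub hq hb h, ← ha.val_shift hq, ← hb.val_shift hq, pow_succ]
  field_simp

theorem Digits.val_eq_iff (hq : 1 < q) {a b : ℕ → ℕ} (ha : Digits M a) (hb : Digits M b) {n : ℕ}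
    (h : ∀ i < n, a i = b i) :
    val q a = val q b ↔ (a n + val q (shift (n + 1) a)) =
      (b n + val q (shift (n + 1) b)) := by
  have h0 : 0 < q := by linarith
  rw [← sub_eq_zero, ha.val_sub' hq hb h, div_eq_zero_iff, sub_eq_zero]
  simp [h0.ne']

theorem Digits.abs_val_sub_le (hq : 1 < q) {a b : ℕ → ℕ} (ha : Digits M a) (hb : Digits M b) {n : ℕ}
    (h : ∀ i < n, a i = b i) : |val q a - val q b| ≤ M / (q - 1) / q ^ n := by
  have h0 : 0 < q := by linarith
  rw [ha.val_sub hq hb h, abs_div, abs_of_pos (pow_pos h0 n)]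
  gcongr
  rw [abs_le]
  have h1 := (ha.digits_shift n).val_le hq
  have h2 := (hb.digits_shift n).val_le hq
  have h3 := val_nonneg hq (shift n a)
  have h4 := val_nonneg hq (shift n b)
  constructor <;> linarith

/-- Dominated convergence: once the bases exceed some `r` with `1 < r < q`, a geometric series in `1
/ r` dominates. Base and digits may vary together, as the limit argument for `Star` requires. -/
theorem tendsto_val {s : ℕ → ℝ} {a : ℕ → ℕ → ℕ} {c : ℕ → ℕ} (hq : 1 < q)
    (hs : Tendsto s atTop (𝓝 q)) (ha : ∀ᶠ n in atTop, Digits M (a n))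
    (hac : ∀ i, ∀ᶠ n in atTop, a n i = c i) :
    Tendsto (fun n => val (s n) (a n)) atTop (𝓝 (val q c)) := by
  obtain ⟨r, hr1, hr2⟩ := exists_between hq
  have h0 : 0 < q := by linarith
  refine tendsto_tsum_of_dominated_convergence (bound := fun i => (M : ℝ) / r ^ (i + 1))
    (hasSum_const hr1 M).summable (fun i => ?_) ?_
  · refine Tendsto.div ?_ (hs.pow (i + 1)) (by positivity)
    refine tendsto_const_nhds.congr' ?_
    filter_upwards [hac i] with n hn
    rw [hn]
  · filter_upwards [ha, hs.eventually (lt_mem_nhds hr2)] with n hn hrn i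
    have hr0 : 0 < r := by linarith
    have hs0 : 0 < s n := by linarith
    have : (a n i : ℝ) ≤ M := by exact_mod_cast hn i
    rw [Real.norm_of_nonneg (by positivity)]
    gcongr

/-- Sequential compactness of the sequences with digits in `{0, …, M}`. -/
theorem exists_subseq_limit {a : ℕ → ℕ → ℕ} (ha : ∀ n, Digits M (a n)) :
    ∃ c : ℕ → ℕ, ∃ φ : ℕ → ℕ, StrictMono φ ∧ ∀ i, ∀ᶠ n in atTop, a (φ n) i = c i := by
  have hK : IsCompact (Set.univ.pi fun _ : ℕ => Set.Iic M) :=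
    isCompact_univ_pi fun _ => (Set.finite_Iic M).isCompact
  obtain ⟨c, _, φ, hφ, h⟩ := hK.tendsto_subseq (x := a) fun n i _ => ha n i
  refine ⟨c, φ, hφ, fun i => ?_⟩
  have := (tendsto_pi_nhds.1 h) i
  rw [nhds_discrete, tendsto_pure] at this
  exact this

theorem eventually_forall_lt_eq {a : ℕ → ℕ → ℕ} {c : ℕ → ℕ}
    (h : ∀ i, ∀ᶠ n in atTop, a n i = c i) (N : ℕ) : ∀ᶠ n in atTop, ∀ i < N, a n i = c i := by
  have := (Filter.eventually_all_finset (Finset.range N)).2 fun i _ => h i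
  simpa using this

theorem isExpansion_iff (hM : (M : ℝ) < q) (hM' : q ≤ M + 1) (hq : 1 < q) {x : ℝ} {c : ℕ → ℕ} :
    IsExpansion q x c ↔ Digits M c ∧ val q c = x := by
  have hd : (∀ i, (c i : ℝ) < q) ↔ Digits M c := by
    refine forall_congr' fun i => ⟨fun h => ?_, fun h => ?_⟩
    · have : (c i : ℝ) < (M + 1 : ℕ) := by push_cast; linarith
      exact Nat.lt_succ_iff.1 (by exact_mod_cast this)
    · have : (c i : ℝ) ≤ M := by exact_mod_cast h
      linarith
  rw [IsExpansion, hd]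
  refine and_congr_right fun h => ⟨fun h' => h'.tsum_eq, ?_⟩
  rintro rfl
  exact h.hasSum hq

/-! ### The quasi-greedy algorithm -/

/-- A digit sequence whose tails have positive value, the value being at most `1` after each digit
different from `M`. -/
structure QG (q : ℝ) (M : ℕ) (a : ℕ → ℕ) : Prop where
  digits : Digits M a
  pos : ∀ n, 0 < val q (shift n a)
  le_one : ∀ n, a n < M → val q (shift (n + 1) a) ≤ 1

/-- The largest digit smaller than `y`. -/
def qgDigit (M : ℕ) (y : ℝ) : ℕ := min M (⌈y⌉₊ - 1)

/-- The remainders of the quasi-greedy algorithm. -/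
def qgRem (q : ℝ) (M : ℕ) (x : ℝ) : ℕ → ℝ
  | 0 => x
  | n + 1 => q * qgRem q M x n - qgDigit M (q * qgRem q M x n)

/-- The sequence of digits that the quasi-greedy algorithm produces. -/
def qgSeq (q : ℝ) (M : ℕ) (x : ℝ) (n : ℕ) : ℕ := qgDigit M (q * qgRem q M x n)

theorem one_le_bound (hq : 1 < q) (hM' : q ≤ M + 1) : 1 ≤ M / (q - 1) := by
  rw [le_div_iff₀ (by linarith)]
  linarith

theorem sub_qgDigit_pos {y : ℝ} (hy : 0 < y) : 0 < y - qgDigit M y := by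
  have h1 : 0 < ⌈y⌉₊ := Nat.ceil_pos.2 hy
  have h2 := Nat.ceil_lt_add_one hy.le
  have h3 : qgDigit M y + 1 ≤ ⌈y⌉₊ := by
    unfold qgDigit
    omega
  have h4 : (qgDigit M y : ℝ) + 1 ≤ ⌈y⌉₊ := by exact_mod_cast h3
  linarith

theorem sub_qgDigit_le_one {y : ℝ} (h : qgDigit M y < M) : y - qgDigit M y ≤ 1 := by
  have h3 : ⌈y⌉₊ ≤ qgDigit M y + 1 := by
    unfold qgDigit at h ⊢
    omega
  have h4 : (⌈y⌉₊ : ℝ) ≤ qgDigit M y + 1 := by exact_mod_cast h3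
  linarith [Nat.le_ceil y]

theorem qgDigit_le (M : ℕ) (y : ℝ) : qgDigit M y ≤ M := min_le_left _ _

theorem qgRem_mem (hq : 1 < q) (hM' : q ≤ M + 1) {x : ℝ} (hx : 0 < x) (hx' : x ≤ M / (q - 1))
    (n : ℕ) : 0 < qgRem q M x n ∧ qgRem q M x n ≤ M / (q - 1) := by
  induction n with
  | zero => exact ⟨hx, hx'⟩
  | succ n ih =>
    have hy : 0 < q * qgRem q M x n := mul_pos (by linarith) ih.1
    refine ⟨sub_qgDigit_pos hy, ?_⟩
    rcases (qgDigit_le M (q * qgRem q M x n)).lt_or_eq with h | h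
    · exact (sub_qgDigit_le_one h).trans (one_le_bound hq hM')
    · rw [qgRem, h]
      have h1 : q * qgRem q M x n ≤ q * (M / (q - 1)) :=
        mul_le_mul_of_nonneg_left ih.2 (by linarith)
      have h2 : q * (M / (q - 1)) - M = M / (q - 1) := by
        have : q - 1 ≠ 0 := by linarith
        field_simp
        ring
      linarith

theorem qgSeq_digits (q : ℝ) (M : ℕ) (x : ℝ) : Digits M (qgSeq q M x) := fun _ => qgDigit_le _ _

theorem val_qgSeq (hq : 1 < q) (hM' : q ≤ M + 1) {x : ℝ} (hx : 0 < x) (hx' : x ≤ M / (q - 1)) :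
    val q (qgSeq q M x) = x := by
  have h0 : 0 < q := by linarith
  refine HasSum.tsum_eq ?_
  rw [hasSum_iff_tendsto_nat_of_nonneg (fun i => by positivity)]
  have hsum : ∀ n, ∑ i ∈ Finset.range n, (qgSeq q M x i : ℝ) / q ^ (i + 1) =
      x - qgRem q M x n / q ^ n := by
    intro n
    induction n with
    | zero => simp [qgRem]
    | succ n ih =>
      rw [Finset.sum_range_succ, ih, qgRem, qgSeq, pow_succ]
      field_simp
      ring
  simp_rw [hsum]
  have hz : Tendsto (fun n => qgRem q M x n / q ^ n) atTop (𝓝 0) := by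
    refine squeeze_zero (g := fun n => M / (q - 1) / q ^ n) (fun n => ?_) (fun n => ?_) ?_
    · exact div_nonneg (qgRem_mem hq hM' hx hx' n).1.le (by positivity)
    · have := (qgRem_mem hq hM' hx hx' n).2
      gcongr
    · exact tendsto_const_nhds.div_atTop (tendsto_pow_atTop_atTop_of_one_lt hq)
  simpa using tendsto_const_nhds.sub hz

theorem qgRem_add (q : ℝ) (M : ℕ) (x : ℝ) (n i : ℕ) :
    qgRem q M (qgRem q M x n) i = qgRem q M x (n + i) := by
  induction i with
  | zero => rfl
  | succ i ih => rw [qgRem, ih, ← add_assoc, qgRem]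

theorem qg_qgSeq (hq : 1 < q) (hM' : q ≤ M + 1) {x : ℝ} (hx : 0 < x) (hx' : x ≤ M / (q - 1)) :
    QG q M (qgSeq q M x) := by
  have hval : ∀ n, val q (shift n (qgSeq q M x)) = qgRem q M x n := by
    intro n
    have h := qgRem_mem hq hM' hx hx' n
    rw [← val_qgSeq hq hM' h.1 h.2]
    congr 1
    funext i
    simp [shift, qgSeq, qgRem_add]
  refine ⟨qgSeq_digits q M x, fun n => ?_, fun n hn => ?_⟩
  · rw [hval]
    exact (qgRem_mem hq hM' hx hx' n).1
  · rw [hval]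
    exact sub_qgDigit_le_one hn

theorem exists_digits_val_eq (hq : 1 < q) (hM' : q ≤ M + 1) {x : ℝ} (hx : 0 ≤ x)
    (hx' : x ≤ M / (q - 1)) : ∃ c, Digits M c ∧ val q c = x := by
  rcases hx.eq_or_lt with rfl | hx
  · exact ⟨0, fun _ => Nat.zero_le _, val_zero q⟩
  · exact ⟨_, qgSeq_digits q M x, val_qgSeq hq hM' hx hx'⟩

/-! ### Comparing values and sequences -/

/-- If `b` first exceeded `a`, the extra unit in its digit would match all that the tail of `a` can
contribute, and the positive tail of `b` would make its value strictly larger. -/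
theorem QG.lexLe_of_val_le (hq : 1 < q) {a b : ℕ → ℕ} (ha : QG q M a) (hb : Digits M b)
    (hpos : ∀ n, 0 < val q (shift n b)) (h : val q b ≤ val q a) : LexLe b a := by
  rw [← not_lexLt]
  rintro ⟨p, hp, hlt⟩
  have h0 : 0 < q := by linarith
  have h1 := ha.le_one p (hlt.trans_le (hb p))
  have h2 := ha.digits.val_sub' hq hb hp
  have h3 : (a p : ℝ) + 1 ≤ b p := by exact_mod_cast hlt
  have h4 := hpos (p + 1)
  have h5 : val q a - val q b < 0 := by
    rw [h2]
    exact div_neg_of_neg_of_pos (by linarith) (by positivity)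
  linarith

theorem pos_of_isInfiniteSeq (hq : 1 < q) {a : ℕ → ℕ} (ha : Digits M a) (h : IsInfiniteSeq a)
    (n : ℕ) : 0 < val q (shift n a) := by
  refine (val_nonneg hq _).lt_of_ne' fun h0 => h ?_
  have h1 := (ha.digits_shift n).eq_zero_of_val hq h0
  refine (Set.finite_Iio n).subset fun i hi => ?_
  by_contra hni
  obtain ⟨j, rfl⟩ := Nat.exists_eq_add_of_le (not_lt.1 hni)
  exact hi (congrFun h1 j)

theorem isInfiniteSeq_of_pos {a : ℕ → ℕ} (h : ∀ n, 0 < val q (shift n a)) : IsInfiniteSeq a := by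
  intro hfin
  obtain ⟨N, hN⟩ := hfin.bddAbove
  have : shift (N + 1) a = 0 := by
    funext i
    by_contra hi
    have := hN (show N + 1 + i ∈ {i | a i ≠ 0} from hi)
    omega
  have h' := h (N + 1)
  rw [this, val_zero] at h'
  exact lt_irrefl _ h'

theorem QG.isQuasiGreedy (hq : 1 < q) (hM : (M : ℝ) < q) (hM' : q ≤ M + 1) {a : ℕ → ℕ}
    (ha : QG q M a) : IsQuasiGreedy q (val q a) a := by
  refine Or.inr ⟨by simpa using (ha.pos 0).ne', ⟨?_, isInfiniteSeq_of_pos ha.pos⟩, ?_⟩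
  · exact (isExpansion_iff hM hM' hq).2 ⟨ha.digits, rfl⟩
  · rintro b ⟨hb, hinf⟩
    obtain ⟨hb, hbv⟩ := (isExpansion_iff hM hM' hq).1 hb
    exact toLex_le_iff.2 (ha.lexLe_of_val_le hq hb (pos_of_isInfiniteSeq hq hb hinf) hbv.le)

theorem isQuasiGreedy_iff (hq : 1 < q) (hM : (M : ℝ) < q) (hM' : q ≤ M + 1) {x : ℝ} (hx : 0 < x)
    (hx' : x ≤ M / (q - 1)) {a : ℕ → ℕ} : IsQuasiGreedy q x a ↔ QG q M a ∧ val q a = x := by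
  constructor
  · rintro (⟨h, -⟩ | ⟨-, h⟩)
    · exact absurd h hx.ne'
    · have h1 := (qg_qgSeq hq hM' hx hx').isQuasiGreedy hq hM hM'
      rw [val_qgSeq hq hM' hx hx'] at h1
      rcases h1 with ⟨h1, -⟩ | ⟨-, h1⟩
      · exact absurd h1 hx.ne'
      · have : a = qgSeq q M x := toLex_inj.1 (h.unique h1)
        rw [this]
        exact ⟨qg_qgSeq hq hM' hx hx', val_qgSeq hq hM' hx hx'⟩
  · rintro ⟨h, rfl⟩
    exact h.isQuasiGreedy hq hM hM'

/-! ### The quasi-greedy expansion of `1` -/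

/-- `M` is the largest digit in base `q`, and `α` is the quasi-greedy expansion of `1`. -/
structure Base (q : ℝ) (M : ℕ) (α : ℕ → ℕ) : Prop where
  one_lt : 1 < q
  lt : (M : ℝ) < q
  le : q ≤ M + 1
  qg : QG q M α
  val_eq : val q α = 1

theorem exists_base (hq : 1 < q) : ∃ M α, Base q M α := by
  have h1 : 0 < ⌈q⌉₊ := Nat.ceil_pos.2 (by linarith)
  obtain ⟨M, hM⟩ := Nat.exists_eq_succ_of_ne_zero h1.ne'
  have hlt : (M : ℝ) < q := Nat.lt_ceil.1 (by omega)
  have hle : q ≤ M + 1 := by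
    have := Nat.le_ceil q
    rw [hM] at this
    exact_mod_cast this
  have h2 := one_le_bound hq hle
  exact ⟨M, qgSeq q M 1, hq, hlt, hle, qg_qgSeq hq hle one_pos h2, val_qgSeq hq hle one_pos h2⟩

namespace Base

variable {α : ℕ → ℕ}

theorem apply_zero (B : Base q M α) : α 0 = M := by
  refine le_antisymm (B.qg.digits 0) (not_lt.1 fun h => ?_)
  have h1 := B.qg.le_one 0 h
  have h2 := B.qg.digits.val_head B.one_lt
  rw [B.val_eq] at h2
  have h3 : (α 0 : ℝ) + 1 ≤ M := by exact_mod_cast h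
  have := B.lt
  rw [zero_add] at h1
  linarith

theorem pos (B : Base q M α) : 0 < M := by
  have h := B.le
  have h1 := B.one_lt
  have : (0 : ℝ) < M := by linarith
  exact_mod_cast this

theorem one_le (B : Base q M α) : 1 ≤ M / (q - 1) := one_le_bound B.one_lt B.le

theorem val_shift_le (B : Base q M α) (n : ℕ) : val q (shift n α) ≤ 1 := by
  induction n with
  | zero =>
    rw [shift_zero, B.val_eq]
  | succ n ih =>
    rcases (B.qg.digits n).lt_or_eq with h | h
    · exact B.qg.le_one n h
    · have h1 := B.qg.digits.val_shift B.one_lt n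
      rw [h] at h1
      have h2 : q * val q (shift n α) ≤ q * 1 :=
        mul_le_mul_of_nonneg_left ih (by linarith [B.one_lt])
      linarith [B.le]

theorem shift_lexLe (B : Base q M α) (n : ℕ) : LexLe (shift n α) α := by
  refine B.qg.lexLe_of_val_le B.one_lt (B.qg.digits.digits_shift n) (fun k => ?_) ?_
  · rw [shift_shift]
    exact B.qg.pos _
  · rw [B.val_eq]
    exact B.val_shift_le n

theorem lexLt_of_val_lt (B : Base q M α) {c : ℕ → ℕ} (hc : Digits M c) (h : val q c < 1) :
    LexLt c α := by
  refine LexLe.lt_of_ne (not_lexLt.1 ?_) fun h' => ?_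
  · rintro ⟨p, hp, hlt⟩
    have h0 : 0 < q := by linarith [B.one_lt]
    have h1 := B.val_shift_le (p + 1)
    have h2 := B.qg.digits.val_sub' B.one_lt hc hp
    have h3 : (α p : ℝ) + 1 ≤ c p := by exact_mod_cast hlt
    have h4 := val_nonneg B.one_lt (shift (p + 1) c)
    have h5 : val q α - val q c ≤ 0 := by
      rw [h2]
      exact div_nonpos_of_nonpos_of_nonneg (by linarith) (by positivity)
    rw [B.val_eq] at h5
    linarith
  · rw [h', B.val_eq] at h
    exact lt_irrefl _ h

/-- The upper lexicographic condition on a sequence of digits. -/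
def Adm (M : ℕ) (α c : ℕ → ℕ) : Prop := ∀ n, c n < M → LexLe (shift (n + 1) c) α

theorem Adm.shift {c : ℕ → ℕ} (h : Adm M α c) (n : ℕ) : Adm M α (shift n c) := fun k hk => by
  rw [shift_shift]
  exact h (n + k) hk

/-- Contraction step: the tail after the first difference satisfies the same hypotheses, so its
excess over 1 is at most `t`, and it counts with a factor of at most `1 / q`. Positivity of the
tails of `α` makes the inequality strict. -/
theorem val_lt_add (B : Base q M α) {c : ℕ → ℕ} (hc : Digits M c) (h : LexLt c α) {t : ℝ}
    (hadm : Adm M α c)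
    (ht : ∀ c, Digits M c → Adm M α c → LexLe c α → val q c ≤ 1 + t) (ht0 : 0 ≤ t) :
    val q c < 1 + t / q := by
  have hq := B.one_lt
  have h0 : 0 < q := by linarith
  obtain ⟨p, hp, hlt⟩ := h
  have h1 := ht _ (hc.digits_shift (p + 1)) (hadm.shift (p + 1))
    (hadm p (hlt.trans_le (B.qg.digits p)))
  have h2 := hc.val_sub' hq B.qg.digits hp
  have h3 : (c p : ℝ) + 1 ≤ α p := by exact_mod_cast hlt
  have h4 := B.qg.pos (p + 1)
  have h5 : val q c - val q α < t / q ^ (p + 1) := by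
    rw [h2]
    gcongr
    linarith
  have h6 : t / q ^ (p + 1) ≤ t / q ^ 1 := by
    gcongr
    · exact hq.le
    · omega
  rw [B.val_eq] at h5
  rw [pow_one] at h6
  linarith

theorem val_le_one (B : Base q M α) {c : ℕ → ℕ} (hc : Digits M c) (hadm : Adm M α c)
    (h : LexLe c α) : val q c ≤ 1 := by
  have hq := B.one_lt
  have h0 : 0 < q := by linarith
  have hB : 0 ≤ M / (q - 1) := by linarith [B.one_le]
  -- The trivial bound `M / (q - 1)` on the excess is divided by `q` at each application of
  -- `val_lt_add`; letting `k` grow removes it.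
  have key : ∀ k : ℕ, ∀ c, Digits M c → Adm M α c → LexLe c α →
      val q c ≤ 1 + M / (q - 1) / q ^ k := by
    intro k
    induction k with
    | zero =>
      intro c hc _ _
      have := hc.val_le hq
      simp only [pow_zero, div_one]
      linarith
    | succ k ih =>
      intro c hc hadm h
      by_cases hne : c = α
      · rw [hne, B.val_eq]
        have : 0 ≤ M / (q - 1) / q ^ (k + 1) := by positivity
        linarith
      · have := B.val_lt_add hc (h.lt_of_ne hne) hadm ih (by positivity)
        rw [div_div, ← pow_succ] at this
        exact this.le
  have hlim : Tendsto (fun k : ℕ => 1 + M / (q - 1) / q ^ k) atTop (𝓝 (1 + 0)) :=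
    tendsto_const_nhds.add (tendsto_const_nhds.div_atTop (tendsto_pow_atTop_atTop_of_one_lt hq))
  rw [add_zero] at hlim
  exact ge_of_tendsto' hlim fun k => key k c hc hadm h

theorem val_lt_one (B : Base q M α) {c : ℕ → ℕ} (hc : Digits M c) (hadm : Adm M α c)
    (h : LexLt c α) : val q c < 1 := by
  have := B.val_lt_add hc h hadm (t := 0)
    (fun c hc ha h => by simpa using B.val_le_one hc ha h) le_rfl
  simpa using this

theorem qg_of_adm (B : Base q M α) {c : ℕ → ℕ} (hc : Digits M c) (hadm : Adm M α c)
    (hinf : IsInfiniteSeq c) : QG q M c :=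
  ⟨hc, pos_of_isInfiniteSeq B.one_lt hc hinf, fun n hn =>
    B.val_le_one (hc.digits_shift _) (hadm.shift _) (hadm n hn)⟩

theorem adm_of_qg (B : Base q M α) {c : ℕ → ℕ} (hc : QG q M c) : Adm M α c := fun n hn => by
  refine B.qg.lexLe_of_val_le B.one_lt (hc.digits.digits_shift _) (fun k => ?_) ?_
  · rw [shift_shift]
    exact hc.pos _
  · rw [B.val_eq]
    exact hc.le_one n hn

end Base

variable {α : ℕ → ℕ}

/-! ### Sequences satisfying the lexicographic conditions on both sides -/

/-- The sequences of digits such that they and their reflections satisfy the weak lexicographic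
conditions. -/
structure Weak (M : ℕ) (α c : ℕ → ℕ) : Prop where
  digits : Digits M c
  adm : Base.Adm M α c
  adm_conj : Base.Adm M α (conj M c)

theorem Weak.conj {c : ℕ → ℕ} (h : Weak M α c) : Weak M α (conj M c) :=
  ⟨digits_conj M c, h.adm_conj, by rw [h.digits.conj_conj]; exact h.adm⟩

/-- The weak upper condition is an equality after position `n`. -/
def UpBranch (M : ℕ) (α c : ℕ → ℕ) (n : ℕ) : Prop := c n < M ∧ shift (n + 1) c = α

/-- One of the weak conditions is an equality after position `n`. -/
def Branch (M : ℕ) (α c : ℕ → ℕ) (n : ℕ) : Prop := UpBranch M α c n ∨ UpBranch M α (conj M c) n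

theorem Branch.conj {c : ℕ → ℕ} (hc : Digits M c) {n : ℕ} (h : Branch M α c n) :
    Branch M α (conj M c) n := by
  rw [Branch, hc.conj_conj]
  exact h.symm

/-- Replace the digit `c n` by `c n + 1` and the subsequent digits by `d`. -/
def raise (c : ℕ → ℕ) (n : ℕ) (d : ℕ → ℕ) : ℕ → ℕ := fun i =>
  if i < n then c i else if i = n then c n + 1 else d (i - (n + 1))

theorem raise_of_lt {c d : ℕ → ℕ} {n i : ℕ} (h : i < n) : raise c n d i = c i := if_pos h

theorem raise_self (c d : ℕ → ℕ) (n : ℕ) : raise c n d n = c n + 1 := by simp [raise]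

theorem shift_raise (c d : ℕ → ℕ) (n : ℕ) : shift (n + 1) (raise c n d) = d := by
  funext i
  have h1 : ¬ n + 1 + i < n := by omega
  have h2 : n + 1 + i ≠ n := by omega
  simp [shift, raise, h1, h2]

theorem eq_raise {b c : ℕ → ℕ} {n : ℕ} (h : ∀ i < n, b i = c i) (hn : b n = c n + 1) :
    b = raise c n (shift (n + 1) b) := by
  funext i
  rcases lt_trichotomy i n with hi | rfl | hi
  · rw [raise_of_lt hi, h i hi]
  · rw [raise_self, hn]
  · rw [raise, if_neg (by omega), if_neg (by omega), shift]
    congr 1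
    omega

theorem Digits.raise {c d : ℕ → ℕ} (hc : Digits M c) (hd : Digits M d) {n : ℕ} (hn : c n < M) :
    Digits M (raise c n d) := by
  intro i
  unfold UniqueExpansions.raise
  split_ifs
  · exact hc i
  · exact hn
  · exact hd _

theorem val_raise (hq : 1 < q) {c d : ℕ → ℕ} (hc : Digits M c) (hd : Digits M d) {n : ℕ}
    (hn : c n < M) (h : val q (shift (n + 1) c) = 1 + val q d) :
    val q (raise c n d) = val q c := by
  rw [(hc.raise hd hn).val_eq_iff hq hc (fun i hi => raise_of_lt hi), raise_self, shift_raise, h]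
  push_cast
  ring

/-! ### All expansions of the value of a weak sequence -/

namespace Base

theorem eq_of_val_eq_one (B : Base q M α) {c : ℕ → ℕ} (hc : Digits M c) (hadm : Adm M α c)
    (h : LexLe c α) (hv : val q c = 1) : c = α := by
  by_contra hne
  exact (B.val_lt_one hc hadm (h.lt_of_ne hne)).ne hv

/-- Raising a digit costs at least one unit, and the tail of `c` can supply at most one. Hence the
digit rises by exactly 1, nothing is left for the tail of `b`, and the tail of `c` has value 1, so
it is `α`. -/
theorem upBranch_of_lt (B : Base q M α) {b c : ℕ → ℕ} (hc : Digits M c) (hadm : Adm M α c)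
    (hb : Digits M b) (hv : val q b = val q c) {n : ℕ} (h : ∀ i < n, b i = c i) (hn : c n < b n) :
    UpBranch M α c n ∧ b = raise c n 0 := by
  have hcn : c n < M := hn.trans_le (hb n)
  have h1 := B.val_le_one (hc.digits_shift (n + 1)) (hadm.shift _) (hadm n hcn)
  have h2 := (hb.val_eq_iff B.one_lt hc h).1 hv
  have h3 : (c n : ℝ) + 1 ≤ b n := by exact_mod_cast hn
  have h4 := val_nonneg B.one_lt (shift (n + 1) b)
  have h5 := (hb.digits_shift (n + 1)).eq_zero_of_val B.one_lt (by linarith)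
  have h6 : b n = c n + 1 := by
    have : (b n : ℝ) = c n + 1 := by linarith
    exact_mod_cast this
  refine ⟨⟨hcn, B.eq_of_val_eq_one (hc.digits_shift _) (hadm.shift _) (hadm n hcn)
    (by linarith)⟩, ?_⟩
  rw [eq_raise h h6, h5]

theorem val_raise_zero (B : Base q M α) {c : ℕ → ℕ} (hc : Digits M c) {n : ℕ}
    (h : UpBranch M α c n) : val q (raise c n 0) = val q c :=
  val_raise (d := 0) B.one_lt hc (fun _ => Nat.zero_le _) h.1 (by rw [h.2, B.val_eq, val_zero, add_zero])

open Classical in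
/-- The expansion that first differs from `c` at the branch position `n`. -/
def branchExp (M : ℕ) (α c : ℕ → ℕ) (n : ℕ) : ℕ → ℕ :=
  if UpBranch M α c n then raise c n 0 else conj M (raise (conj M c) n 0)

theorem branchExp_spec (B : Base q M α) {c : ℕ → ℕ} (hc : Digits M c) {n : ℕ}
    (h : Branch M α c n) : Digits M (branchExp M α c n) ∧ val q (branchExp M α c n) = val q c ∧
      (∀ i < n, branchExp M α c n i = c i) ∧ branchExp M α c n n ≠ c n := by
  have hz : Digits M 0 := fun _ => Nat.zero_le _
  by_cases hu : UpBranch M α c n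
  · rw [branchExp, if_pos hu]
    refine ⟨hc.raise hz hu.1, B.val_raise_zero hc hu, fun i hi => raise_of_lt hi, ?_⟩
    rw [raise_self]
    omega
  · have hd := h.resolve_left hu
    have hc' := digits_conj M c
    rw [branchExp, if_neg hu]
    refine ⟨digits_conj _ _, ?_, fun i hi => ?_, ?_⟩
    · rw [(hc'.raise hz hd.1).val_conj B.one_lt, B.val_raise_zero hc' hd, hc.val_conj B.one_lt]
      ring
    · have := hc i
      simp only [conj, raise_of_lt hi]
      omega
    · have h1 := hd.1
      have h2 := hc n
      simp only [conj, raise_self] at h1 ⊢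
      omega

theorem not_upBranch_both (B : Base q M α) {c : ℕ → ℕ} {n : ℕ} (h : UpBranch M α c n) :
    ¬ UpBranch M α (conj M c) n := by
  intro h'
  have h1 := congrFun h.2 0
  have h2 := congrFun h'.2 0
  have h3 := B.pos
  rw [B.apply_zero] at h1 h2
  simp only [shift, conj] at h1 h2
  omega

theorem expansions_eq (B : Base q M α) {c : ℕ → ℕ} (hc : Weak M α c) :
    expansions q (val q c) = insert c (branchExp M α c '' {n | Branch M α c n}) := by
  ext b
  rw [expansions, Set.mem_ofPred_eq, isExpansion_iff B.lt B.le B.one_lt]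
  constructor
  · rintro ⟨hb, hv⟩
    by_cases hne : b = c
    · exact Or.inl hne
    · obtain ⟨n, hn, hne⟩ := exists_first_diff hne
      right
      rcases hne.lt_or_gt with hlt | hlt
      · have hlt' : conj M c n < conj M b n := by
          have := hc.digits n
          simp only [conj]
          omega
        obtain ⟨h1, h2⟩ := B.upBranch_of_lt (b := conj M b) hc.conj.digits hc.adm_conj
          (digits_conj M b) (by rw [hb.val_conj B.one_lt, hc.digits.val_conj B.one_lt, hv])
          (fun i hi => by simp only [conj, hn i hi]) hlt'
        refine ⟨n, Or.inr h1, ?_⟩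
        rw [branchExp, if_neg fun h => B.not_upBranch_both h h1, ← h2, hb.conj_conj]
      · obtain ⟨h1, h2⟩ := B.upBranch_of_lt hc.digits hc.adm hb hv hn hlt
        refine ⟨n, Or.inl h1, ?_⟩
        rw [branchExp, if_pos h1, h2]
  · rintro (rfl | ⟨n, hn, rfl⟩)
    · exact ⟨hc.digits, rfl⟩
    · have := B.branchExp_spec hc.digits hn
      exact ⟨this.1, this.2.1⟩

theorem branchExp_injOn (B : Base q M α) {c : ℕ → ℕ} (hc : Digits M c) :
    Set.InjOn (branchExp M α c) {n | Branch M α c n} := by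
  intro m hm n hn h
  have h1 := B.branchExp_spec hc hm
  have h2 := B.branchExp_spec hc hn
  rcases lt_trichotomy m n with hmn | hmn | hmn
  · exact absurd ((congrFun h m).trans (h2.2.2.1 m hmn)) h1.2.2.2
  · exact hmn
  · exact absurd ((congrFun h n).symm.trans (h1.2.2.1 n hmn)) h2.2.2.2

theorem not_mem_image_branchExp (B : Base q M α) {c : ℕ → ℕ} (hc : Digits M c) :
    c ∉ branchExp M α c '' {n | Branch M α c n} := by
  rintro ⟨n, hn, h⟩
  exact (B.branchExp_spec hc hn).2.2.2 (congrFun h n)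

/-! ### Unique expansions -/

theorem mem_U_iff (B : Base q M α) {x : ℝ} :
    x ∈ U q ↔ ∃ c, (Digits M c ∧ val q c = x) ∧ ∀ b, Digits M b → val q b = x → b = c := by
  simp only [U, Set.mem_ofPred_eq, ExistsUnique, isExpansion_iff B.lt B.le B.one_lt, and_imp]

theorem val_mem_U_iff (B : Base q M α) {c : ℕ → ℕ} (hc : Weak M α c) :
    val q c ∈ U q ↔ ∀ n, ¬ Branch M α c n := by
  have hexp : ∀ b, b ∈ expansions q (val q c) ↔ Digits M b ∧ val q b = val q c := fun b =>
    isExpansion_iff B.lt B.le B.one_lt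
  rw [B.mem_U_iff]
  constructor
  · rintro ⟨d, -, hd⟩ n hn
    have h1 := B.branchExp_spec hc.digits hn
    have h2 := hd _ h1.1 h1.2.1
    have h3 := hd _ hc.digits rfl
    exact h1.2.2.2 (by rw [h2, h3])
  · intro h
    refine ⟨c, ⟨hc.digits, rfl⟩, fun b hb hv => ?_⟩
    have := (hexp b).2 ⟨hb, hv⟩
    rw [B.expansions_eq hc] at this
    rcases this with h' | ⟨n, hn, -⟩
    · exact h'
    · exact absurd hn (h n)

/-- With a tail of value at least 1, the digit could be raised and the remainder expanded anew,
giving a second expansion. -/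
theorem val_shift_lt_one_of_unique (B : Base q M α) {c : ℕ → ℕ} (hc : Digits M c)
    (huniq : ∀ b, Digits M b → val q b = val q c → b = c) {n : ℕ} (hn : c n < M) :
    val q (shift (n + 1) c) < 1 := by
  by_contra! h
  obtain ⟨d, hd, hv⟩ := exists_digits_val_eq (x := val q (shift (n + 1) c) - 1) B.one_lt B.le
    (by linarith) (by linarith [(hc.digits_shift (n + 1)).val_le B.one_lt])
  have h1 := huniq _ (hc.raise hd hn) (val_raise B.one_lt hc hd hn (by rw [hv]; ring))
  have h2 := congrFun h1 n
  rw [raise_self] at h2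
  omega

theorem unique_conj (hq : 1 < q) {c : ℕ → ℕ} (hc : Digits M c)
    (huniq : ∀ b, Digits M b → val q b = val q c → b = c) :
    ∀ b, Digits M b → val q b = val q (conj M c) → b = conj M c := by
  intro b hb hv
  rw [← huniq (conj M b) (digits_conj M b) ?_, hb.conj_conj]
  rw [hb.val_conj hq, hv, hc.val_conj hq]
  ring

theorem weak_of_unique (B : Base q M α) {c : ℕ → ℕ} (hc : Digits M c)
    (huniq : ∀ b, Digits M b → val q b = val q c → b = c) : Weak M α c :=
  ⟨hc, fun _ hn => (B.lexLt_of_val_lt (hc.digits_shift _)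
    (B.val_shift_lt_one_of_unique hc huniq hn)).le,
  fun _ hn => (B.lexLt_of_val_lt ((digits_conj M c).digits_shift _)
    (B.val_shift_lt_one_of_unique (digits_conj M c) (unique_conj B.one_lt hc huniq) hn)).le⟩

theorem mem_U_iff_exists_weak (B : Base q M α) {x : ℝ} :
    x ∈ U q ↔ ∃ c, Weak M α c ∧ (∀ n, ¬ Branch M α c n) ∧ val q c = x := by
  constructor
  · intro hx
    obtain ⟨c, ⟨hc, rfl⟩, hu⟩ := B.mem_U_iff.1 hx
    have hw := B.weak_of_unique hc hu
    exact ⟨c, hw, (B.val_mem_U_iff hw).1 hx, rfl⟩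
  · rintro ⟨c, hc, hb, rfl⟩
    exact (B.val_mem_U_iff hc).2 hb

/-! ### The set `V q` -/

theorem cast_ceil_sub_one (B : Base q M α) : ((⌈q⌉ : ℤ) : ℝ) - 1 = M := by
  have : ⌈q⌉ = (M : ℤ) + 1 := by
    rw [Int.ceil_eq_iff]
    push_cast
    exact ⟨by linarith [B.lt], B.le⟩
  rw [this]
  push_cast
  ring

theorem isQuasiGreedy_one_iff (B : Base q M α) {a : ℕ → ℕ} : IsQuasiGreedy q 1 a ↔ a = α := by
  constructor
  · intro h
    have h2 := B.qg.isQuasiGreedy B.one_lt B.lt B.le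
    rw [B.val_eq] at h2
    rcases h with ⟨h, -⟩ | ⟨-, h⟩
    · exact absurd h one_ne_zero
    rcases h2 with ⟨h2, -⟩ | ⟨-, h2⟩
    · exact absurd h2 one_ne_zero
    · exact toLex_inj.1 (h.unique h2)
  · rintro rfl
    have h2 := B.qg.isQuasiGreedy B.one_lt B.lt B.le
    rwa [B.val_eq] at h2

theorem conj_lt_iff (B : Base q M α) (c : ℕ → ℕ) (n : ℕ) : conj M c n < M ↔ 0 < c n := by
  have := B.pos
  simp only [conj]
  omega

/-- A weakly admissible sequence with a last nonzero digit exists only if `α` is constant. -/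
theorem eq_const_of_weak (B : Base q M α) {c : ℕ → ℕ} (hc : Weak M α c) (h0 : c ≠ 0)
    (hinf : ¬ IsInfiniteSeq c) : α = fun _ => M := by
  have hfin : {i | c i ≠ 0}.Finite := Set.not_infinite.1 hinf
  have hne : {i | c i ≠ 0}.Nonempty := by
    by_contra h
    refine h0 (funext fun i => ?_)
    by_contra hi
    exact h ⟨i, hi⟩
  obtain ⟨n, hn, hmax⟩ := hfin.exists_maximal hne
  have hz : shift (n + 1) (conj M c) = fun _ => M := by
    funext i
    have : c (n + 1 + i) = 0 := by
      by_contra hi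
      have := hmax (show n + 1 + i ∈ {i | c i ≠ 0} from hi) (by omega)
      omega
    simp [shift, conj, this]
  have h1 := hc.adm_conj n ((B.conj_lt_iff c n).2 (Nat.pos_of_ne_zero hn))
  rw [hz] at h1
  funext i
  by_contra hi
  obtain ⟨p, hp, hpne⟩ := exists_first_diff (fun h => hi (congrFun h i) : α ≠ fun _ => M)
  have h2 := h1 p fun i hi => (hp i hi).symm
  exact hpne (le_antisymm (B.qg.digits p) h2)

theorem weak_of_eq_const (hα : α = fun _ => M) {c : ℕ → ℕ} (hc : Digits M c) : Weak M α c := by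
  subst hα
  exact ⟨hc, fun _ _ _ _ => hc _, fun _ _ _ _ => digits_conj M c _⟩

/-- The definition of `V` states only the reflected condition; the other one is automatic for
quasi-greedy sequences. Conversely, an infinite weak sequence is itself quasi-greedy. -/
theorem mem_V_iff (B : Base q M α) {x : ℝ} : x ∈ V q ↔ ∃ c, Weak M α c ∧ val q c = x := by
  have hJ : x ∈ J q ↔ 0 ≤ x ∧ x ≤ M / (q - 1) := by
    rw [J, B.cast_ceil_sub_one, Set.mem_Icc]
  have hsh : ∀ (a : ℕ → ℕ) n, (fun i => M - a (n + 1 + i)) = shift (n + 1) (conj M a) :=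
    fun a n => rfl
  have hfwd : ∀ a, QG q M a → Weak M α a → val q a ∈ V q := by
    intro a hqg ha
    refine ⟨?_, α, a, B.isQuasiGreedy_one_iff.2 rfl, hqg.isQuasiGreedy B.one_lt B.lt B.le,
      fun n hn => ?_⟩
    · rw [J, B.cast_ceil_sub_one, Set.mem_Icc]
      exact ⟨val_nonneg B.one_lt a, ha.digits.val_le B.one_lt⟩
    · rw [B.apply_zero, hsh]
      exact toLex_le_iff.2 (ha.adm_conj n ((B.conj_lt_iff a n).2 hn))
  constructor
  · rintro ⟨hx, α', a, hα', ha, hcond⟩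
    rw [hJ] at hx
    obtain rfl := B.isQuasiGreedy_one_iff.1 hα'
    rw [B.apply_zero] at hcond
    have hconj : Adm M α' (conj M a) := fun n hn => by
      have := hcond n ((B.conj_lt_iff a n).1 hn)
      rw [hsh] at this
      exact toLex_le_iff.1 this
    rcases hx.1.eq_or_lt with h0 | hpos
    · have ha0 : a = 0 := by
        rcases ha with ⟨-, h⟩ | ⟨h, -⟩
        · exact h
        · exact absurd h0.symm h
      subst ha0
      exact ⟨0, ⟨fun _ => Nat.zero_le _, fun n _ p _ => Nat.zero_le _, hconj⟩, by rw [val_zero, h0]⟩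
    · obtain ⟨hqg, hv⟩ := (isQuasiGreedy_iff B.one_lt B.lt B.le hpos hx.2).1 ha
      exact ⟨a, ⟨hqg.digits, B.adm_of_qg hqg, hconj⟩, hv⟩
  · rintro ⟨c, hc, rfl⟩
    by_cases h0 : c = 0
    · subst h0
      refine ⟨hJ.2 ?_, α, 0, B.isQuasiGreedy_one_iff.2 rfl, Or.inl ⟨val_zero q, rfl⟩, ?_⟩
      · rw [val_zero]
        exact ⟨le_rfl, by linarith [B.one_le]⟩
      · intro n hn
        exact absurd hn (lt_irrefl _)
    · by_cases hinf : IsInfiniteSeq c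
      · exact hfwd c (B.qg_of_adm hc.digits hc.adm hinf) hc
      -- Here `c` is not quasi-greedy. But `α` is constantly `M`, so every digit sequence is weak
      -- and the quasi-greedy expansion can replace `c`.
      · have hα := B.eq_const_of_weak hc h0 hinf
        have hpos : 0 < val q c := (val_nonneg B.one_lt c).lt_of_ne' fun h =>
          h0 (hc.digits.eq_zero_of_val B.one_lt h)
        have hle := hc.digits.val_le B.one_lt
        have := hfwd _ (qg_qgSeq B.one_lt B.le hpos hle) (weak_of_eq_const hα (qgSeq_digits _ _ _))
        rwa [val_qgSeq B.one_lt B.le hpos hle] at this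

theorem U_subset_V (B : Base q M α) : U q ⊆ V q := fun x hx => by
  obtain ⟨c, hc, -, h⟩ := B.mem_U_iff_exists_weak.1 hx
  exact B.mem_V_iff.2 ⟨c, hc, h⟩

theorem mem_V_diff_U_iff (B : Base q M α) {x : ℝ} :
    x ∈ V q \ U q ↔ ∃ c, Weak M α c ∧ (∃ n, Branch M α c n) ∧ val q c = x := by
  constructor
  · rintro ⟨hV, hU⟩
    obtain ⟨c, hc, rfl⟩ := B.mem_V_iff.1 hV
    rw [B.val_mem_U_iff hc] at hU
    push Not at hU
    exact ⟨c, hc, hU, rfl⟩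
  · rintro ⟨c, hc, ⟨n, hn⟩, rfl⟩
    exact ⟨B.mem_V_iff.2 ⟨c, hc, rfl⟩, fun h => (B.val_mem_U_iff hc).1 h n hn⟩

/-- Each instance of the weak conditions involves finitely many digits, so these conditions pass to
a termwise limit, which exists by compactness. -/
theorem isClosed_V (B : Base q M α) : IsClosed (V q) := by
  refine isClosed_of_closure_subset fun x hx => ?_
  obtain ⟨s, hs, hlim⟩ := mem_closure_iff_seq_limit.1 hx
  choose a ha hv using fun n => B.mem_V_iff.1 (hs n)
  obtain ⟨c, φ, hφ, hc⟩ := exists_subseq_limit fun n => (ha n).digits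
  have hN := eventually_forall_lt_eq hc
  have hval : Tendsto (fun n => val q (a (φ n))) atTop (𝓝 (val q c)) :=
    tendsto_val B.one_lt tendsto_const_nhds (Eventually.of_forall fun n => (ha _).digits) hc
  simp_rw [hv] at hval
  refine B.mem_V_iff.2 ⟨c, ⟨fun i => ?_, fun n hn p hp => ?_, fun n hn p hp => ?_⟩,
    tendsto_nhds_unique hval (hlim.comp hφ.tendsto_atTop)⟩
  · obtain ⟨k, hk⟩ := (hc i).exists
    rw [← hk]
    exact (ha _).digits i
  · obtain ⟨k, hk⟩ := (hN (n + 1 + p + 1)).exists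
    rw [shift, ← hk _ (by omega)]
    refine (ha (φ k)).adm n (by rwa [hk _ (by omega)]) p fun i hi => ?_
    rw [← hp i hi, shift, shift, hk _ (by omega)]
  · obtain ⟨k, hk⟩ := (hN (n + 1 + p + 1)).exists
    rw [shift, conj, ← hk _ (by omega)]
    refine (ha (φ k)).adm_conj n (by rwa [conj, hk _ (by omega)]) p fun i hi => ?_
    rw [← hp i hi, shift, shift, conj, conj, hk _ (by omega)]

end Base

/-! ### The closure of the set of univoque bases -/

/-- Every reflected tail of `α` is smaller than `α`. -/
def Star (M : ℕ) (α : ℕ → ℕ) : Prop := ∀ k, LexLt (conj M (shift k α)) α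

/-- A prefix consisting of a block and its reflection propagates: `h1` bounds each later digit
below, `h2` bounds it above, and the bounds coincide. Thus an equality on `k` digits becomes an
equality of sequences. -/
theorem conj_shift_eq_of_prefix {γ : ℕ → ℕ} (hd : Digits M γ) {k : ℕ} (hk : 0 < k)
    (h1 : LexLe (conj M (shift k γ)) γ) (h2 : LexLe (shift (2 * k) γ) γ)
    (h : ∀ i < k, M - γ (k + i) = γ i) : conj M (shift k γ) = γ := by
  have key : ∀ N, M - γ (k + N) = γ N := by
    intro N
    induction N using Nat.strong_induction_on with
    | _ N ih =>
      rcases lt_or_ge N k with hN | hN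
      · exact h N hN
      obtain ⟨j, rfl⟩ := Nat.exists_eq_add_of_le hN
      have e1 := h1 (k + j) fun i hi => ih i hi
      have e2 := h2 j fun i hi => by
        have a1 := ih (k + i) (by omega)
        have a2 := ih i (by omega)
        have a3 := hd (k + (k + i))
        have a4 := hd (k + i)
        have a5 := hd i
        rw [shift, show 2 * k + i = k + (k + i) by ring]
        omega
      have e3 := ih j (by omega)
      have e4 := hd (k + (k + j))
      have e5 := hd (k + j)
      simp only [shift, conj] at e1 e2
      rw [show 2 * k + j = k + (k + j) by ring] at e2
      omega
  exact funext key

namespace Base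

theorem mem_univoqueBases_iff (B : Base q M α) : q ∈ univoqueBases ↔ (1 : ℝ) ∈ U q := by
  simp only [univoqueBases, U, Set.mem_ofPred_eq, B.one_lt, true_and]

theorem unique_of_univoque (B : Base q M α) (h : q ∈ univoqueBases) :
    ∀ b, Digits M b → val q b = val q α → b = α := by
  obtain ⟨c, -, hc⟩ := B.mem_U_iff.1 (B.mem_univoqueBases_iff.1 h)
  intro b hb hv
  rw [hc b hb (hv.trans B.val_eq), hc α B.qg.digits B.val_eq]

theorem val_conj_shift_lt_one (B : Base q M α) (h : q ∈ univoqueBases) (k : ℕ) :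
    val q (conj M (shift (k + 1) α)) < 1 := by
  have hu := unique_conj B.one_lt B.qg.digits (B.unique_of_univoque h)
  have hpos : ∀ k, 0 < α k → val q (conj M (shift (k + 1) α)) < 1 := fun k hk =>
    B.val_shift_lt_one_of_unique (digits_conj M α) hu ((B.conj_lt_iff α k).2 hk)
  induction k with
  | zero =>
    refine hpos 0 ?_
    rw [B.apply_zero]
    exact B.pos
  | succ k ih =>
    -- Uniqueness speaks only about tails after a nonzero digit. Across a zero digit the tail of `α`
    -- is multiplied by `q`, so the reflected value does not increase.
    rcases Nat.eq_zero_or_pos (α (k + 1)) with h0 | h0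
    · have h1 := B.qg.digits.val_shift B.one_lt (k + 1)
      rw [(B.qg.digits.digits_shift _).val_conj B.one_lt] at ih ⊢
      rw [h0, Nat.cast_zero, zero_add] at h1
      have h2 := mul_le_mul_of_nonneg_right B.one_lt.le (val_nonneg B.one_lt (shift (k + 1) α))
      linarith
    · exact hpos _ h0

theorem conj_lexLt (B : Base q M α) : LexLt (conj M α) α :=
  ⟨0, fun i hi => absurd hi (Nat.not_lt_zero i), by
    rw [conj, B.apply_zero, Nat.sub_self]
    exact B.pos⟩

theorem star_of_univoque (B : Base q M α) (h : q ∈ univoqueBases) : Star M α := by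
  intro k
  rcases k with _ | k
  · rw [shift_zero]
    exact B.conj_lexLt
  · exact B.lexLt_of_val_lt (digits_conj _ _) (B.val_conj_shift_lt_one h k)

theorem mem_univoqueBases_of_eq (B : Base q M α) (h : q = M + 1) : q ∈ univoqueBases := by
  rw [B.mem_univoqueBases_iff, B.mem_U_iff]
  have h1 : (M : ℝ) / (q - 1) = 1 := by
    have : (M : ℝ) ≠ 0 := by exact_mod_cast B.pos.ne'
    rw [h, add_sub_cancel_right, div_self this]
  have key : ∀ b, Digits M b → val q b = 1 → b = fun _ => M := by
    intro b hb hv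
    have h2 := hb.val_conj B.one_lt
    rw [hv, h1, sub_self] at h2
    have h3 := (digits_conj M b).eq_zero_of_val B.one_lt h2
    funext i
    have h4 := congrFun h3 i
    have h5 := hb i
    simp only [conj, Pi.zero_apply] at h4
    omega
  refine ⟨α, ⟨B.qg.digits, B.val_eq⟩, fun b hb hv => ?_⟩
  rw [key b hb hv, key α B.qg.digits B.val_eq]

/-- Any bound away from 1 would do: it ensures that `1 < q` persists on the closure. -/
theorem three_halves_lt (B : Base q M α) (h : q ∈ univoqueBases) : 3 / 2 < q := by
  by_contra! hq
  have h1 := B.val_conj_shift_lt_one h 0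
  rw [(B.qg.digits.digits_shift _).val_conj B.one_lt, zero_add] at h1
  have h2 := B.qg.digits.val_head B.one_lt
  rw [B.val_eq, B.apply_zero] at h2
  have h3 : (1 : ℝ) ≤ M := by exact_mod_cast B.pos
  have h4 : 2 ≤ M / (q - 1) := by
    rw [le_div_iff₀ (by linarith [B.one_lt])]
    linarith
  linarith

end Base

theorem three_halves_le_of_mem_closure (h : q ∈ closure univoqueBases) : 3 / 2 ≤ q := by
  refine closure_minimal (fun x hx => ?_) isClosed_Ici h
  obtain ⟨M, α, B⟩ := exists_base hx.1
  exact (B.three_halves_lt hx).le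

/-- For a non-univoque `q`, take univoque bases tending to `q` whose expansions of 1 converge
termwise. The limit is quasi-greedy, hence `α`, and inherits the weak inequalities; strictness comes
from `conj_shift_eq_of_prefix`. -/
theorem Base.star (B : Base q M α) (h : q ∈ closure univoqueBases) : Star M α := by
  by_cases hU : q ∈ univoqueBases
  · exact B.star_of_univoque hU
  -- Strictness on both sides of `q` gives all nearby bases the same largest digit `M`.
  have hlt : q < M + 1 := B.le.lt_of_ne fun h => hU (B.mem_univoqueBases_of_eq h)
  obtain ⟨s', hs', hlim'⟩ := mem_closure_iff_seq_limit.1 h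
  obtain ⟨N, hN⟩ := eventually_atTop.1
    (hlim'.eventually ((lt_mem_nhds B.lt).and (gt_mem_nhds hlt)))
  have hbase : ∀ n, ∃ a, Base (s' (n + N)) M a := by
    intro n
    obtain ⟨M', a, B'⟩ := exists_base (hs' (n + N)).1
    have h1 := hN (n + N) (by omega)
    have h2 := B'.lt
    have h3 := B'.le
    have e1 : (M' : ℝ) < (M + 1 : ℕ) := by push_cast; linarith
    have e2 : (M : ℝ) < (M' + 1 : ℕ) := by push_cast; linarith
    have e3 : M' = M := by
      have e1 : M' < M + 1 := by exact_mod_cast e1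
      have e2 : M < M' + 1 := by exact_mod_cast e2
      omega
    exact ⟨a, e3 ▸ B'⟩
  choose a' Ba' using hbase
  obtain ⟨γ, φ, hφ, hγ⟩ := exists_subseq_limit fun n => (Ba' n).qg.digits
  have hlim : Tendsto (fun n => s' (φ n + N)) atTop (𝓝 q) :=
    hlim'.comp ((tendsto_add_atTop_nat N).comp hφ.tendsto_atTop)
  have hmem : ∀ n, s' (φ n + N) ∈ univoqueBases := fun n => hs' _
  have Ba : ∀ n, Base (s' (φ n + N)) M (a' (φ n)) := fun n => Ba' _
  generalize hs : (fun n => s' (φ n + N)) = s at hlim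
  generalize ha : (fun n => a' (φ n)) = a
  have hs1 : ∀ n, s' (φ n + N) = s n := fun n => congrFun hs n
  have ha1 : ∀ n, a' (φ n) = a n := fun n => congrFun ha n
  simp only [hs1, ha1] at hmem Ba hγ
  have hq := B.one_lt
  have hdig : Digits M γ := fun i => by
    obtain ⟨n, hn⟩ := (hγ i).exists
    rw [← hn]
    exact (Ba n).qg.digits i
  have htail : ∀ k, Tendsto (fun n => val (s n) (shift k (a n))) atTop (𝓝 (val q (shift k γ))) :=
    fun k => tendsto_val hq hlim (Eventually.of_forall fun n => (Ba n).qg.digits.digits_shift k)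
      fun i => hγ (k + i)
  have htail' : ∀ k, Tendsto (fun n => val (s n) (conj M (shift k (a n)))) atTop
      (𝓝 (val q (conj M (shift k γ)))) := fun k =>
    tendsto_val hq hlim (Eventually.of_forall fun n => digits_conj _ _) fun i => by
      filter_upwards [hγ (k + i)] with n hn
      simp only [conj, shift, hn]
  have hle : ∀ k, val q (shift k γ) ≤ 1 := fun k =>
    le_of_tendsto' (htail k) fun n => (Ba n).val_shift_le k
  have hle' : ∀ k, val q (conj M (shift (k + 1) γ)) ≤ 1 := fun k =>
    le_of_tendsto' (htail' (k + 1)) fun n => ((Ba n).val_conj_shift_lt_one (hmem n) k).le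
  have hval : val q γ = 1 := by
    have h1 := htail 0
    simp only [shift_zero, fun n => (Ba n).val_eq] at h1
    exact tendsto_nhds_unique h1 tendsto_const_nhds |>.symm ▸ rfl
  have Bγ : Base q M γ := by
    refine ⟨hq, B.lt, B.le, ⟨hdig, fun k => ?_, fun k _ => hle (k + 1)⟩, hval⟩
    rcases k with _ | k
    · rw [shift_zero, hval]
      exact one_pos
    -- A reflected tail is worth at most 1 while the total `M / (q - 1)` exceeds 1, so the tail
    -- itself stays positive in the limit.
    · have h1 := hle' k
      rw [(hdig.digits_shift _).val_conj hq] at h1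
      have h2 : 1 < M / (q - 1) := by
        rw [lt_div_iff₀ (by linarith)]
        linarith
      linarith
  have hαγ : α = γ := by
    have h1 := B.isQuasiGreedy_one_iff.2 rfl
    exact Bγ.isQuasiGreedy_one_iff.1 h1
  subst hαγ
  have hstar : ∀ n, Star M (a n) := fun n => (Ba n).star_of_univoque (hmem n)
  have hN' := eventually_forall_lt_eq hγ
  intro k
  rcases Nat.eq_zero_or_pos k with rfl | hk
  · rw [shift_zero]
    exact B.conj_lexLt
  have hlexle : LexLe (conj M (shift k α)) α := by
    intro p hp
    obtain ⟨n, hn⟩ := (hN' (k + p + 1)).exists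
    have h1 := (hstar n k).le p fun i hi => by
      have := hp i hi
      simp only [conj, shift] at this ⊢
      rw [hn _ (by omega), hn _ (by omega), this]
    simp only [conj, shift] at h1 ⊢
    rwa [hn _ (by omega), hn _ (by omega)] at h1
  refine hlexle.lt_of_ne fun heq => ?_
  -- An approximant sharing the first `2k` digits already has the self-propagating prefix, against
  -- its own `Star`.
  obtain ⟨n, hn⟩ := (hN' (k + k)).exists
  refine (hstar n k).ne (conj_shift_eq_of_prefix (Ba n).qg.digits hk (hstar n k).le
    ((Ba n).shift_lexLe _) fun i hi => ?_)
  have := congrFun heq i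
  simp only [conj, shift] at this
  rw [hn _ (by omega), hn _ (by omega), this]

/-! ### Truncations -/

/-- There are arbitrarily large positions before which all comparisons of tails of `c` with `α`
that started earlier have been decided. -/
theorem exists_decided {c : ℕ → ℕ} (hα : ∀ k, LexLe (shift k α) α) {S : Set ℕ}
    (hS : ∀ k ∈ S, LexLt (shift k c) α) (n : ℕ) :
    ∃ m ≥ n, (m = n ∨ ∃ j p, m = j + 1 ∧ c j < α p) ∧
      ∀ k ∈ S, k < m → ∃ p, k + p < m ∧ (∀ i < p, c (k + i) = α i) ∧ c (k + p) < α p := by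
  classical
  by_cases hgood : ∃ k, k ∈ S ∧ k < n ∧
      ¬ ∃ p, k + p < n ∧ (∀ i < p, c (k + i) = α i) ∧ c (k + p) < α p
  · obtain ⟨hkS, hkn, hk⟩ := Nat.find_spec hgood
    have hmin := fun j => Nat.find_min hgood (m := j)
    generalize Nat.find hgood = k at hkS hkn hk hmin
    obtain ⟨p, hp, hlt⟩ := hS k hkS
    have hnp : n ≤ k + p := by
      by_contra! h
      exact hk ⟨p, h, hp, hlt⟩
    -- Cut just after the earliest undecided comparison is settled. A later one still open there
    -- would exhibit a tail of `α` exceeding `α`.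
    refine ⟨k + p + 1, by omega, Or.inr ⟨k + p, p, rfl, hlt⟩, fun k' hk'S hk' => ?_⟩
    rcases lt_trichotomy k' k with h | rfl | h
    · have := hmin k' h
      push Not at this
      obtain ⟨p', h1, h2⟩ := this hk'S (h.trans hkn)
      exact ⟨p', by omega, h2⟩
    · exact ⟨p, by omega, hp, hlt⟩
    · obtain ⟨p', hp', hlt'⟩ := hS k' hk'S
      refine ⟨p', ?_, hp', hlt'⟩
      by_contra! hge
      obtain ⟨d, rfl⟩ := Nat.exists_eq_add_of_lt h
      obtain ⟨r, rfl⟩ : ∃ r, p = d + 1 + r := ⟨p - (d + 1), by omega⟩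
      have h1 := hp' r (by omega)
      have h2 := hα (d + 1) r fun i hi => by
        have a1 := hp' i (by omega)
        have a2 := hp (d + 1 + i) (by omega)
        simp only [shift] at a1 a2 ⊢
        rw [← a1, ← a2]
        congr 1
        ring
      simp only [shift] at h1 h2 hlt
      rw [show k + d + 1 + r = k + (d + 1 + r) by ring] at h1
      omega
  · push Not at hgood
    exact ⟨n, le_rfl, Or.inl rfl, hgood⟩

/-- The first `m` terms of `w`, followed by `α`. -/
def splice (w : ℕ → ℕ) (m : ℕ) (α : ℕ → ℕ) : ℕ → ℕ := fun i => if i < m then w i else α (i - m)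

theorem splice_of_lt (w α : ℕ → ℕ) {m i : ℕ} (h : i < m) : splice w m α i = w i := if_pos h

theorem splice_add (w α : ℕ → ℕ) (m i : ℕ) : splice w m α (m + i) = α i := by simp [splice]

theorem shift_splice_add (w α : ℕ → ℕ) (m j : ℕ) : shift (m + j) (splice w m α) = shift j α := by
  funext i
  rw [shift, add_assoc, splice_add, shift]

theorem shift_splice (w α : ℕ → ℕ) (m : ℕ) : shift m (splice w m α) = α :=
  shift_splice_add w α m 0 |>.trans (shift_zero α)

namespace Base

/-- Upper comparisons must be settled before the cut. Lower ones may remain tied: past the cut they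
pit the reflection of `α` against a tail of `α`, which `Star` decides. -/
theorem weak_splice (B : Base q M α) (hstar : Star M α) {w : ℕ → ℕ} (hw : Digits M w) {m : ℕ}
    (hup : ∀ n, n + 1 < m → w n < M →
      ∃ p, n + 1 + p < m ∧ (∀ i < p, w (n + 1 + i) = α i) ∧ w (n + 1 + p) < α p)
    (hdown : ∀ n, n + 1 < m → 0 < w n → ∀ p, n + 1 + p < m →
      (∀ i < p, M - w (n + 1 + i) = α i) → M - w (n + 1 + p) ≤ α p) :
    Weak M α (splice w m α) := by
  have hα := B.qg.digits
  refine ⟨fun i => ?_, fun n hn => ?_, fun n hn => ?_⟩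
  · unfold splice
    split_ifs
    · exact hw i
    · exact hα _
  · rcases lt_or_ge (n + 1) m with h | h
    · rw [splice_of_lt _ _ (by omega)] at hn
      obtain ⟨p, hp, hp', hlt⟩ := hup n h hn
      refine LexLt.le ⟨p, fun i hi => ?_, ?_⟩
      · rw [shift, splice_of_lt _ _ (by omega), hp' i hi]
      · rwa [shift, splice_of_lt _ _ hp]
    · obtain ⟨j, hj⟩ := Nat.exists_eq_add_of_le h
      rw [hj, shift_splice_add]
      exact B.shift_lexLe j
  · rw [B.conj_lt_iff] at hn
    rw [← conj_shift]
    rcases lt_or_ge (n + 1) m with h | h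
    · rw [splice_of_lt _ _ (by omega)] at hn
      intro p hp
      simp only [conj, shift] at hp ⊢
      rcases lt_or_ge (n + 1 + p) m with hpm | hpm
      · rw [splice_of_lt _ _ hpm]
        refine hdown n h hn p hpm fun i hi => ?_
        rw [← hp i hi, splice_of_lt _ _ (by omega)]
      · obtain ⟨j, rfl⟩ := Nat.exists_eq_add_of_lt h
        obtain ⟨r, rfl⟩ : ∃ r, p = j + 1 + r := ⟨p - (j + 1), by omega⟩
        have e : ∀ i, splice w (n + 1 + j + 1) α (n + 1 + (j + 1 + i)) = α i := fun i => by
          rw [← splice_add w α (n + 1 + j + 1) i]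
          congr 1
          ring
        have h1 := (hstar (j + 1)).le r fun i hi => by
          have h2 := hp (j + 1 + i) (by omega)
          rw [e] at h2
          have h3 := hα i
          simp only [conj, shift]
          omega
        simp only [conj, shift] at h1
        rw [e]
        omega
    · obtain ⟨j, hj⟩ := Nat.exists_eq_add_of_le h
      rw [hj, shift_splice_add]
      exact (hstar j).le

/-- Whichever tail starts later is a tail of the other one; so a reflected tail of `α` would equal
`α`. -/
theorem conj_tail_ne (B : Base q M α) (hstar : Star M α) {a : ℕ → ℕ} {k L : ℕ}
    (hL : shift L a = α) : shift k (conj M a) ≠ α := by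
  intro hk
  rcases le_total k L with h | h
  · obtain ⟨d, rfl⟩ := Nat.exists_eq_add_of_le h
    refine (hstar d).ne ?_
    nth_rewrite 1 [← hk]
    rw [shift_shift, ← conj_shift, hL, B.qg.digits.conj_conj]
  · obtain ⟨d, rfl⟩ := Nat.exists_eq_add_of_le h
    refine (hstar d).ne ?_
    nth_rewrite 1 [← hL]
    rw [shift_shift, conj_shift, hk]

/-- Lower one digit of `a` by 1 far out and restart `α` after it. The position is chosen so that all
strict comparisons of reflected tails are already settled. -/
theorem exists_weak_ne (B : Base q M α) (hstar : Star M α) {a : ℕ → ℕ} (ha : Weak M α a) {L : ℕ}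
    (hL : shift L a = α) (N : ℕ) :
    ∃ b, Weak M α b ∧ (∀ i < N, b i = a i) ∧ val q b ≠ val q a := by
  have htail : ∀ j, LexLt (shift (L + j) (conj M a)) α := fun j => by
    rw [← conj_shift, ← shift_shift, hL]
    exact hstar j
  obtain ⟨m, hm, -, hdec⟩ := exists_decided (c := conj M a) B.shift_lexLe
    (S := {k | LexLt (shift k (conj M a)) α}) (fun k hk => hk) (N + L + 1)
  obtain ⟨t, rfl⟩ : ∃ t, m = L + t + 1 := ⟨m - L - 1, by omega⟩
  have hpos : 0 < a (L + t) := by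
    -- The comparison starting at the last position has room for one digit only, so it is settled
    -- there and the digit can be lowered.
    obtain ⟨p, hp, -, hlt⟩ := hdec (L + t) (htail t) (by omega)
    obtain rfl : p = 0 := by omega
    rwa [B.apply_zero, add_zero, B.conj_lt_iff] at hlt
  set w : ℕ → ℕ := fun i => if i = L + t then a i - 1 else a i with hw
  have hwlt : ∀ i < L + t, w i = a i := fun i hi => if_neg hi.ne
  have hwL : w (L + t) = a (L + t) - 1 := if_pos rfl
  have hwd : Digits M w := fun i => by
    have := ha.digits i
    simp only [hw]
    split_ifs <;> omega
  have hweak : Weak M α (splice w (L + t + 1) α) := by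
    refine B.weak_splice hstar hwd (fun n hn hnM => ?_) (fun n hn hn0 p hp hagree => ?_)
    · rw [hwlt n (by omega)] at hnM
      have hle := ha.adm n hnM
      obtain ⟨j, hj⟩ : ∃ j, L + t = n + 1 + j := ⟨L + t - (n + 1), by omega⟩
      by_cases hall : ∃ i, i < j ∧ a (n + 1 + i) ≠ α i
      · classical
        obtain ⟨h1, h2⟩ := Nat.find_spec hall
        have hmin := fun i => Nat.find_min hall (m := i)
        generalize Nat.find hall = p at h1 h2 hmin
        have hag : ∀ i < p, a (n + 1 + i) = α i := fun i hi => by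
          have := hmin i hi
          push Not at this
          exact this (by omega)
        refine ⟨p, by omega, fun i hi => ?_, ?_⟩
        · rw [hwlt _ (by omega), hag i hi]
        · rw [hwlt _ (by omega)]
          exact lt_of_le_of_ne (hle p hag) h2
      -- A comparison tied up to the last position is made strict by the lowered digit.
      · push Not at hall
        have h1 := hle j hall
        refine ⟨j, by omega, fun i hi => ?_, ?_⟩
        · rw [hwlt _ (by omega), hall i hi]
        · rw [shift, ← hj] at h1
          rw [← hj, hwL]
          omega
    · rw [hwlt n (by omega)] at hn0
      have hk := (ha.adm_conj n ((B.conj_lt_iff a n).2 hn0)).lt_of_ne (B.conj_tail_ne hstar hL)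
      obtain ⟨r, hr, hragree, hrlt⟩ := hdec (n + 1) hk hn
      simp only [conj] at hragree hrlt
      rcases lt_trichotomy p r with h | rfl | h
      · rw [hwlt _ (by omega), hragree p h]
      -- Lowering the digit raises its reflection by 1, which the strict inequality `hrlt` absorbs.
      · rcases eq_or_ne (n + 1 + p) (L + t) with he | he
        · rw [he] at hrlt ⊢
          rw [hwL]
          omega
        · rw [hwlt _ (by omega)]
          exact hrlt.le
      · have h1 := hagree r h
        rw [hwlt _ (by omega)] at h1
        omega
  refine ⟨_, hweak, fun i hi => ?_, fun hv => ?_⟩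
  · rw [splice_of_lt _ _ (by omega), hwlt _ (by omega)]
  · rw [hweak.digits.val_eq_iff B.one_lt ha.digits (n := L + t) fun i hi => by
      rw [splice_of_lt _ _ (by omega), hwlt _ hi], splice_of_lt _ _ (by omega), hwL, shift_splice,
      B.val_eq, Nat.cast_sub hpos, add_assoc, ← shift_shift, hL] at hv
    have := B.qg.pos (t + 1)
    push_cast at hv
    linarith

theorem exists_branch (B : Base q M α) (hstar : Star M α) {c : ℕ → ℕ} (hc : Weak M α c)
    (hnb : ∀ n, ¬ Branch M α c n) (hinf : ∀ N, ∃ n ≥ N, c n < M) (N : ℕ) :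
    ∃ b, Weak M α b ∧ (∃ n, Branch M α b n) ∧ ∀ i < N, b i = c i := by
  obtain ⟨n₀, hn₀, hlt₀⟩ := hinf N
  obtain ⟨m, hm, hlast, hdec⟩ := exists_decided (c := c) B.shift_lexLe
    (S := {k | ∃ j, k = j + 1 ∧ c j < M}) (by
      rintro _ ⟨j, rfl, hj⟩
      exact (hc.adm j hj).lt_of_ne fun h => hnb j (Or.inl ⟨hj, h⟩)) (n₀ + 1)
  obtain ⟨j, rfl, hj⟩ : ∃ j, m = j + 1 ∧ c j < M := by
    rcases hlast with h | ⟨j, p, h, hlt⟩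
    · exact ⟨n₀, h, hlt₀⟩
    · exact ⟨j, h, hlt.trans_le (B.qg.digits p)⟩
  refine ⟨splice c (j + 1) α, B.weak_splice hstar hc.digits (fun n hn hnM => ?_)
    (fun n hn hn0 p hp hagree => ?_), ⟨j, Or.inl ⟨?_, shift_splice _ _ _⟩⟩, fun i hi => ?_⟩
  · exact hdec (n + 1) ⟨n, rfl, hnM⟩ hn
  · exact hc.adm_conj n ((B.conj_lt_iff c n).2 hn0) p hagree
  · rwa [splice_of_lt _ _ (by omega)]
  · rw [splice_of_lt _ _ (by omega)]

end Base

/-! ### Topology and cardinality of `V q \ U q` -/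

namespace Base

theorem exists_agree_dist_lt (B : Base q M α) {ε : ℝ} (hε : 0 < ε) : ∃ N : ℕ, ∀ a b : ℕ → ℕ,
    Digits M a → Digits M b → (∀ i < N, a i = b i) → dist (val q a) (val q b) < ε := by
  have hlim : Tendsto (fun n : ℕ => M / (q - 1) / q ^ n) atTop (𝓝 0) :=
    tendsto_const_nhds.div_atTop (tendsto_pow_atTop_atTop_of_one_lt B.one_lt)
  obtain ⟨N, hN⟩ := (hlim.eventually (gt_mem_nhds hε)).exists
  exact ⟨N, fun a b ha hb h => (ha.abs_val_sub_le B.one_lt hb h).trans_lt hN⟩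

theorem accPt_of_mem_diff (B : Base q M α) (hstar : Star M α) {x : ℝ} (hx : x ∈ V q \ U q) :
    AccPt x (𝓟 (V q)) := by
  obtain ⟨a, ha, ⟨n, hn⟩, rfl⟩ := B.mem_V_diff_U_iff.1 hx
  rw [accPt_iff_nhds]
  intro u hu
  obtain ⟨ε, hε, hball⟩ := Metric.mem_nhds_iff.1 hu
  obtain ⟨N, hN⟩ := B.exists_agree_dist_lt hε
  rcases hn with hn | hn
  · obtain ⟨b, hb, hag, hne⟩ := B.exists_weak_ne hstar ha hn.2 N
    exact ⟨val q b, ⟨hball (hN b a hb.digits ha.digits hag), B.mem_V_iff.2 ⟨b, hb, rfl⟩⟩, hne⟩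
  · obtain ⟨b, hb, hag, hne⟩ := B.exists_weak_ne hstar ha.conj hn.2 N
    refine ⟨val q (conj M b), ⟨hball (hN _ a hb.conj.digits ha.digits fun i hi => ?_),
      B.mem_V_iff.2 ⟨_, hb.conj, rfl⟩⟩, fun h => hne ?_⟩
    · rw [← ha.digits.conj_conj, conj, hag i hi]
      rfl
    · rw [hb.digits.val_conj B.one_lt] at h
      rw [ha.digits.val_conj B.one_lt]
      linarith

theorem U_subset_closure_diff (B : Base q M α) (hstar : Star M α) :
    U q ⊆ closure (V q \ U q) := by
  intro x hx
  obtain ⟨c, hc, hnb, rfl⟩ := B.mem_U_iff_exists_weak.1 hx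
  rw [Metric.mem_closure_iff]
  intro ε hε
  obtain ⟨N, hN⟩ := B.exists_agree_dist_lt hε
  by_cases hinf : ∀ N, ∃ n ≥ N, c n < M
  · obtain ⟨b, hb, hbr, hag⟩ := B.exists_branch hstar hc hnb hinf N
    exact ⟨_, B.mem_V_diff_U_iff.2 ⟨b, hb, hbr, rfl⟩,
      hN c b hc.digits hb.digits fun i hi => (hag i hi).symm⟩
  · push Not at hinf
    obtain ⟨n₀, hn₀⟩ := hinf
    have hinf' : ∀ N, ∃ n ≥ N, conj M c n < M := fun N =>
      ⟨max N n₀, le_max_left _ _, (B.conj_lt_iff _ _).2 (B.pos.trans_le (hn₀ _ (le_max_right _ _)))⟩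
    have hnb' : ∀ n, ¬ Branch M α (conj M c) n := fun n hn => hnb n <| by
      simpa only [hc.digits.conj_conj] using hn.conj hc.conj.digits
    obtain ⟨b, hb, ⟨n, hbr⟩, hag⟩ := B.exists_branch hstar hc.conj hnb' hinf' N
    refine ⟨_, B.mem_V_diff_U_iff.2 ⟨conj M b, hb.conj, ⟨n, hbr.conj hb.digits⟩, rfl⟩,
      hN c _ hc.digits hb.conj.digits fun i hi => ?_⟩
    rw [← hc.digits.conj_conj, conj, ← hag i hi]
    rfl

theorem V_subset_closure_diff (B : Base q M α) (hstar : Star M α) :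
    V q ⊆ closure (V q \ U q) := fun x hx => by
  by_cases hU : x ∈ U q
  · exact B.U_subset_closure_diff hstar hU
  · exact subset_closure ⟨hx, hU⟩

theorem countable_diff (B : Base q M α) : (V q \ U q).Countable := by
  have key : ∀ c : ℕ → ℕ, ∀ n, shift (n + 1) c = α →
      ∃ l : List ℕ, c = fun i => if i < l.length then l.getD i 0 else α (i - l.length) := by
    intro c n h
    refine ⟨(List.range (n + 1)).map c, funext fun i => ?_⟩
    by_cases hi : i < n + 1
    · simp [hi, List.getD_eq_getElem?_getD]
    · obtain ⟨j, rfl⟩ := Nat.exists_eq_add_of_le (not_lt.1 hi)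
      rw [← h]
      simp only [shift, List.length_map, List.length_range, if_neg hi, Nat.add_sub_cancel_left]
  refine ((Set.countable_range fun l : List ℕ =>
    val q fun i => if i < l.length then l.getD i 0 else α (i - l.length)).union
    (Set.countable_range fun l : List ℕ => M / (q - 1) -
    val q fun i => if i < l.length then l.getD i 0 else α (i - l.length))).mono ?_
  intro x hx
  obtain ⟨c, hc, ⟨n, hn⟩, rfl⟩ := B.mem_V_diff_U_iff.1 hx
  rcases hn with hn | hn
  · obtain ⟨l, hl⟩ := key c n hn.2
    exact Or.inl ⟨l, congrArg (val q) hl.symm⟩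
  · obtain ⟨l, hl⟩ := key _ n hn.2
    refine Or.inr ⟨l, ?_⟩
    simp only [← hl]
    rw [hc.digits.val_conj B.one_lt]
    ring

/-- Near a point of `V q` outside `closure (U q)`, all of `V q` is branching and without isolated
points; a nonempty perfect set contains a copy of the Cantor space, against countability. -/
theorem closure_U (B : Base q M α) (hstar : Star M α) : closure (U q) = V q := by
  refine (closure_minimal B.U_subset_V B.isClosed_V).antisymm fun x hx => ?_
  by_contra hxU
  obtain ⟨r, hr, hball⟩ := Metric.isOpen_iff.1 isClosed_closure.isOpen_compl x hxU
  have hdiff : V q ∩ Metric.ball x r ⊆ V q \ U q := fun y hy =>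
    ⟨hy.1, fun hyU => hball hy.2 (subset_closure hyU)⟩
  have hpre : Preperfect (V q ∩ Metric.ball x (r / 2)) := by
    intro y hy
    have hy' := hdiff ⟨hy.1, Metric.ball_subset_ball (by linarith) hy.2⟩
    rw [Set.inter_comm]
    exact (B.accPt_of_mem_diff hstar hy').nhds_inter (Metric.isOpen_ball.mem_nhds hy.2)
  -- Halving the radius keeps the closure inside the ball that avoids `U q`.
  have hsub : closure (V q ∩ Metric.ball x (r / 2)) ⊆ V q \ U q := by
    intro y hy
    refine hdiff ⟨closure_minimal Set.inter_subset_left B.isClosed_V hy, ?_⟩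
    have h1 := Metric.closure_ball_subset_closedBall (closure_mono Set.inter_subset_right hy)
    exact Metric.closedBall_subset_ball (by linarith) h1
  obtain ⟨f, hf, -, hinj⟩ := hpre.perfect_closure.exists_nat_bool_injection
    ⟨x, subset_closure ⟨hx, Metric.mem_ball_self (by linarith)⟩⟩
  have := (B.countable_diff.mono (hf.trans hsub)).to_subtype
  have hle := Cardinal.mk_le_aleph0_iff.2 (Equiv.ofInjective f hinj).injective.countable
  have hlt := Cardinal.cantor Cardinal.aleph0
  simp only [Cardinal.mk_pi, Cardinal.mk_fintype, Fintype.card_bool, Nat.cast_ofNat,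
    Cardinal.prod_const', Cardinal.mk_nat] at hle
  exact hle.not_gt hlt

theorem infinite_diff (B : Base q M α) (hstar : Star M α) : (V q \ U q).Infinite := by
  intro hfin
  have h1 := B.V_subset_closure_diff hstar
  rw [hfin.isClosed.closure_eq] at h1
  have h2 : U q = ∅ := Set.eq_empty_of_forall_notMem fun x hx => (h1 (B.U_subset_V hx)).2 hx
  have h3 := B.closure_U hstar
  rw [h2, closure_empty] at h3
  have h4 : val q 0 ∈ V q := B.mem_V_iff.2 ⟨0, ⟨fun _ => Nat.zero_le _,
    fun _ _ _ _ => Nat.zero_le _, fun n hn => absurd ((B.conj_lt_iff _ _).1 hn) (lt_irrefl _)⟩, rfl⟩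
  rw [← h3] at h4
  exact h4

/-! ### The number of expansions -/

theorem not_upBranch_conj (B : Base q M α) (hstar : Star M α) {a : ℕ → ℕ} {m n : ℕ}
    (hm : UpBranch M α a m) : ¬ UpBranch M α (conj M a) n := fun hn =>
  B.conj_tail_ne hstar hm.2 hn.2

/-- The later of two branches lies in the tail `α` following the earlier, so it would be a branch of
`α`. -/
theorem upBranch_subsingleton (hα : ∀ n, ¬ UpBranch M α α n) {a : ℕ → ℕ} {m n : ℕ}
    (hm : UpBranch M α a m) (hn : UpBranch M α a n) : m = n := by
  have key : ∀ {m n}, UpBranch M α a m → UpBranch M α a n → ¬ m < n := by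
    intro m n hm hn h
    obtain ⟨d, rfl⟩ := Nat.exists_eq_add_of_lt h
    refine hα d ⟨?_, ?_⟩
    · rw [← hm.2, shift, show m + 1 + d = m + d + 1 by ring]
      exact hn.1
    · nth_rewrite 1 [← hm.2]
      rw [shift_shift, ← hn.2]
      congr 1
      ring
  exact le_antisymm (not_lt.1 (key hn hm)) (not_lt.1 (key hm hn))

theorem infinite_upBranch {k : ℕ} (hk : UpBranch M α α k) {a : ℕ → ℕ} {n : ℕ}
    (hn : UpBranch M α a n) : {n | UpBranch M α a n}.Infinite := by
  refine Set.infinite_of_not_bddAbove ?_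
  rintro ⟨N, hN⟩
  have key : ∀ j, ∃ m ≥ j, UpBranch M α a m := by
    intro j
    induction j with
    | zero => exact ⟨n, Nat.zero_le _, hn⟩
    | succ j ih =>
      obtain ⟨m, hm, hum⟩ := ih
      refine ⟨m + 1 + k, by omega, ?_, ?_⟩
      · have := hk.1
        rw [← hum.2] at this
        exact this
      · rw [add_assoc, ← shift_shift, hum.2, hk.2]
  obtain ⟨m, hm, hum⟩ := key (N + 1)
  have := hN hum
  omega

theorem weak_self (B : Base q M α) (hstar : Star M α) : Weak M α α :=
  ⟨B.qg.digits, fun _ _ => B.shift_lexLe _, fun n _ => (hstar (n + 1)).le⟩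

theorem not_upBranch_conj_self (hstar : Star M α) (n : ℕ) : ¬ UpBranch M α (conj M α) n :=
  fun h => (hstar (n + 1)).ne h.2

theorem mk_expansions_eq_two (B : Base q M α) (hstar : Star M α) (hq : q ∈ univoqueBases) {x : ℝ}
    (hx : x ∈ V q \ U q) : Cardinal.mk (expansions q x) = 2 := by
  have hα : ∀ n, ¬ UpBranch M α α n := fun n h => by
    have h1 := B.mem_univoqueBases_iff.1 hq
    rw [← B.val_eq, B.val_mem_U_iff (B.weak_self hstar)] at h1
    exact h1 n (Or.inl h)
  obtain ⟨c, hc, ⟨n, hn⟩, rfl⟩ := B.mem_V_diff_U_iff.1 hx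
  have hset : {n | Branch M α c n} = {n} := by
    refine Set.eq_singleton_iff_unique_mem.2 ⟨hn, fun m hm => ?_⟩
    rcases hm with hm | hm <;> rcases hn with hn | hn
    · exact upBranch_subsingleton hα hm hn
    · exact absurd hn (B.not_upBranch_conj hstar hm)
    · exact absurd hm (B.not_upBranch_conj hstar hn)
    · exact upBranch_subsingleton hα hm hn
  have hmem := B.not_mem_image_branchExp hc.digits
  rw [B.expansions_eq hc]
  rw [hset, Set.image_singleton] at hmem ⊢
  rw [Cardinal.mk_insert hmem, Cardinal.mk_singleton]
  exact one_add_one_eq_two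

theorem mk_expansions_eq_aleph0 (B : Base q M α) (hstar : Star M α) (hq : q ∉ univoqueBases)
    {x : ℝ} (hx : x ∈ V q \ U q) : Cardinal.mk (expansions q x) = Cardinal.aleph0 := by
  obtain ⟨k, hk⟩ : ∃ k, UpBranch M α α k := by
    rw [B.mem_univoqueBases_iff, ← B.val_eq, B.val_mem_U_iff (B.weak_self hstar)] at hq
    push Not at hq
    obtain ⟨k, hk⟩ := hq
    exact ⟨k, hk.resolve_right (not_upBranch_conj_self hstar k)⟩
  obtain ⟨c, hc, ⟨n, hn⟩, rfl⟩ := B.mem_V_diff_U_iff.1 hx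
  have hinf : {n | Branch M α c n}.Infinite := by
    rcases hn with hn | hn
    · exact (infinite_upBranch hk hn).mono fun m hm => Or.inl hm
    · exact (infinite_upBranch hk hn).mono fun m hm => Or.inr hm
  rw [B.expansions_eq hc]
  have h1 : (insert c (branchExp M α c '' {n | Branch M α c n})).Countable :=
    ((Set.to_countable _).image _).insert c
  have h2 : (insert c (branchExp M α c '' {n | Branch M α c n})).Infinite :=
    (hinf.image (B.branchExp_injOn hc.digits)).mono (Set.subset_insert _ _)
  have := h1.to_subtype
  have := h2.to_subtype
  exact Cardinal.mk_eq_aleph0 _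

end Base

end UniqueExpansions

end

theorem theorem1p3 (q : ℝ) (hq : q ∈ closure UniqueExpansions.univoqueBases) :
    closure (UniqueExpansions.U q) = UniqueExpansions.V q ∧
    (Cardinal.mk ↥(UniqueExpansions.V q \ UniqueExpansions.U q) = Cardinal.aleph0 ∧
      UniqueExpansions.V q ⊆ closure (UniqueExpansions.V q \ UniqueExpansions.U q)) ∧
    (q ∈ UniqueExpansions.univoqueBases →
      ∀ x ∈ UniqueExpansions.V q \ UniqueExpansions.U q,
        Cardinal.mk ↥(UniqueExpansions.expansions q x) = 2) ∧
    (q ∉ UniqueExpansions.univoqueBases →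
      ∀ x ∈ UniqueExpansions.V q \ UniqueExpansions.U q,
        Cardinal.mk ↥(UniqueExpansions.expansions q x) = Cardinal.aleph0) := by
  have h1 : 1 < q := by linarith [UniqueExpansions.three_halves_le_of_mem_closure hq]
  obtain ⟨M, α, B⟩ := UniqueExpansions.exists_base h1
  have hstar := B.star hq
  have := B.countable_diff.to_subtype
  have := (B.infinite_diff hstar).to_subtype
  exact ⟨B.closure_U hstar, ⟨Cardinal.mk_eq_aleph0 _, B.V_subset_closure_diff hstar⟩,
    fun h x hx => B.mk_expansions_eq_two hstar h hx,
    fun h x hx => B.mk_expansions_eq_aleph0 hstar h hx⟩
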